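/- **Setting.** For $n\ge 0$ let $Y(n)$ be the category whose objects are the complete parenthesizations of a list of length at least $n$ (and at least $1$), with $n$ variables inserted, in some order, into $n$ distinct slots and the unit inserted into the other slots; there is exactly one morphism from any object of $Y(n)$ to any other. Let $\mathcal C$ be a symmetric monoidal category with product $\oplus$. Each $t\in\operatorname{Ob}Y(n)$ gives a functor $\mathcal C^n\to\mathcal C$, $\mathbf x\mapsto t(\mathbf x)$. For $s,t\in \operatorname{Ob}Y(n)$, the morphism $s\to t$ acts as a natural isomorphism $s(\mathbf x)\cong t(\mathbf x)$ which is a composite of associativity, unit and symmetry isomorphisms. Write $t\cdot\sigma$, $\gamma$ and $1\in Y(1)$ for the symmetric group actions, composition and unit of the operad $Y$. Let $\kappa=(\kappa_n)_{n\ge0}$ be any sequence of functions $\kappa_n:\operatorname{Ob}\mathcal C^n\to\operatorname{Ob}Y(n)$, and put $\overline\kappa\mathbf x=\kappa_n(\mathbf x)(\mathbf x)$. The *underlying multicategory* $U_\kappa\mathcal C$ has the objects of $\mathcal C$ as objects and morphism sets $U_\kappa\mathcal C(\mathbf x;y)=\mathcal C(\overline\kappa\mathbf x,y)$, where morphisms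 with different sources are regarded as different. Its structure is as follows, where all isomorphisms marked $\cong$ are those given by the unique morphisms of $Y$. * The identity of $a$ is $\overline\kappa(a)=\kappa_1(a)(a)\cong 1(a)=a$. * For $\sigma\in\Sigma_n$ and $\sigma^{-1}\mathbf x=(x_{\sigma(1)},\dots,x_{\sigma(n)})$, the map $\sigma^*:U_\kappa\mathcal C(\mathbf x;y)\to U_\kappa\mathcal C(\sigma^{-1}\mathbf x;y)$ is precomposition with $\overline\kappa(\sigma^{-1}\mathbf x)\cong(\kappa_n(\mathbf x)\cdot\sigma)(\sigma^{-1}\mathbf x)=\overline\kappa\mathbf x$. * The composite of $g\in U_\kappa\mathcal C(\mathbf y;z)$ with $f_s\in U_\kappa\mathcal C(\mathbf x_s;y_s)$, $1\le s\le n$, where $\mathbf x_s$ has length $j_s$, is $$\overline\kappa(\mathbf x_1\odot\cdots\odot\mathbf x_n)\cong\gamma\big(\kappa_n(\mathbf y);\kappa_{j_1}(\mathbf x_1),\dots,\kappa_{j_n}(\mathbf x_n)\big)(\mathbf x_1\odot\cdots\odot\mathbf x_n)=\kappa_n(\mathbf y)(\overline\kappa\mathbf x_1,\dots,\overline\kappa\mathbf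 x_n)\xrightarrow{\kappa_n(\mathbf y)(f_1,\dots,f_n)}\overline\kappa\mathbf y\xrightarrow{\ g\ }z,$$ where $\odot$ is concatenation. Let $F:\mathcal C\to\mathcal D$ be a lax symmetric monoidal functor with structure maps $\eta:e_{\mathcal D}\to Fe_{\mathcal C}$ and $\xi:Fa\oplus Fb\to F(a\oplus b)$. For $t\in\operatorname{Ob}Y(n)$ these induce, by recursion on the parenthesization, a map $\xi_t:t(F\mathbf x)\to F(t(\mathbf x))$ (namely $\eta$ on a unit, the identity on a variable, and $\xi\circ(\xi_{s}\oplus\xi_{s'})$ on a product of $s$ and $s'$). For choices $\kappa$ on $\mathcal C$ and $\kappa'$ on $\mathcal D$, let $U F:U_\kappa\mathcal C\to U_{\kappa'}\mathcal D$ be $F$ on objects and send $f:\overline\kappa\mathbf x\to y$ to $$\overline{\kappa'}(F\mathbf x)\cong\kappa_n(\mathbf x)(F\mathbf x)\xrightarrow{\xi_{\kappa_n(\mathbf x)}}F(\overline\kappa\mathbf x)\xrightarrow{Ff}Fy .$$ **Corollary 2.5.** Let $\mathcal T$ be a category of symmetric monoidal categories all of whose morphisms are at least lax symmetric monoidal functors;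 that is, $\mathcal T$ is a category with a functor $P$ to the category of symmetric monoidal categories and lax symmetric monoidal functors. Then: 1. For all objects $c$ of $\mathcal T$, all $s,t\in\operatorname{Ob}Y(n)$ and all $\mathbf x\in\operatorname{Ob}P(c)^n$, any two formal composites of structural isomorphisms from $s$ to $t$ denote the same morphism $s(\mathbf x)\to t(\mathbf x)$ of $P(c)$, so that the isomorphisms used above are well defined. 2. For every choice of a sequence $\kappa^c$ on $P(c)$ for each object $c$ of $\mathcal T$, there is a functor $U_\kappa$ from $\mathcal T$ to the category of (symmetric) multicategories and multifunctors, with $U_\kappa(c)=U_{\kappa^c}P(c)$ and $U_\kappa(f)=U(P(f))$. 3. For any two choices $\kappa,\lambda$ there is a natural isomorphism $U_\kappa\cong U_\lambda$ which at $c$ is the identity on objects and sends $f:\overline{\kappa^c}\mathbf x\to y$ to $\overline{\lambda^c}\mathbf x\cong\overline{\kappa^c}\mathbf x\xrightarrow{f}y$. These isomorphisms are coherent: that from $U_\kappa$ to itself is the identity, and $U_\kappa\cong U_\lambda\cong U_\rho$ composes to $U_\kappa\cong U_\rho$. -/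

import Mathlib

open CategoryTheory MonoidalCategory

universe v u

namespace UnderlyingMulticat

/-! ## Symmetric multicategories and multifunctors -/

section Tuples

variable {n : ℕ} {j : Fin n → ℕ}

/-- The concatenation `x₁ ⊙ ⋯ ⊙ xₙ` of a tuple of tuples.  (The equivalence `finSigmaFinEquiv`
lists the pairs `(s, t)` with `s < n`, `t < j s` in lexicographic order.) -/
def concat {A : Type*} (x : ∀ s : Fin n, Fin (j s) → A) : Fin (∑ s, j s) → A :=
  fun k => x (finSigmaFinEquiv.symm k).1 (finSigmaFinEquiv.symm k).2

/-- The block permutation of `j₁ + ⋯ + jₙ` letters given by a permutation `σ` of the `n` blocks.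
It satisfies `concat x ∘ blockPerm σ j = concat (fun s => x (σ s))`, up to the identification of
`j₁ + ⋯ + jₙ` with `j (σ 1) + ⋯ + j (σ n)`. -/
def blockPerm (σ : Equiv.Perm (Fin n)) (j : Fin n → ℕ) : Equiv.Perm (Fin (∑ s, j s)) :=
  (finCongr (Equiv.sum_comp σ j).symm).trans
    (finSigmaFinEquiv.symm.trans
      ((Equiv.sigmaCongrLeft (β := fun s => Fin (j s)) σ).trans finSigmaFinEquiv))

/-- The block sum `τ₁ ⊕ ⋯ ⊕ τₙ` of permutations. -/
def sumPerm (τ : ∀ s : Fin n, Equiv.Perm (Fin (j s))) : Equiv.Perm (Fin (∑ s, j s)) :=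
  finSigmaFinEquiv.symm.trans ((Equiv.sigmaCongrRight τ).trans finSigmaFinEquiv)

end Tuples

/-- The data of a (symmetric) multicategory, without its axioms: objects, `n`-morphisms with an
`n`-tuple of objects as source and a single object as target, identities, the actions of the
symmetric groups, and the composition `Γ`.  For a permutation `σ`, the tuple `x ∘ σ` is
`(x_{σ(1)}, …, x_{σ(n)})`. -/
structure MulticatData where
  Ob : Type u
  Hom : {n : ℕ} → (Fin n → Ob) → Ob → Type v
  unit : (a : Ob) → Hom (fun _ : Fin 1 => a) a
  act : {n : ℕ} → {x : Fin n → Ob} → {y : Ob} → (σ : Equiv.Perm (Fin n)) →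
    Hom x y → Hom (x ∘ σ) y
  comp : {n : ℕ} → {j : Fin n → ℕ} → {x : ∀ s, Fin (j s) → Ob} → {y : Fin n → Ob} → {z : Ob} →
    Hom y z → (∀ s, Hom (x s) (y s)) → Hom (concat x) z

/-- The axioms of a (symmetric) multicategory.  Heterogeneous equality is used where the sources of
the two sides are equal tuples, but not by definition. -/
structure MulticatData.IsMulticategory (M : MulticatData.{v, u}) : Prop where
  act_one : ∀ {n : ℕ} {x : Fin n → M.Ob} {y : M.Ob} (f : M.Hom x y), M.act 1 f = f
  act_mul : ∀ {n : ℕ} {x : Fin n → M.Ob} {y : M.Ob} (σ τ : Equiv.Perm (Fin n)) (f : M.Hom x y),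
    M.act (σ * τ) f = M.act τ (M.act σ f)
  comp_unit : ∀ {n : ℕ} {y : Fin n → M.Ob} {z : M.Ob} (g : M.Hom y z),
    HEq (M.comp g (fun s => M.unit (y s))) g
  unit_comp : ∀ {n : ℕ} {x : Fin n → M.Ob} {z : M.Ob} (g : M.Hom x z),
    HEq (M.comp (M.unit z) (fun _ : Fin 1 => g)) g
  assoc : ∀ {n : ℕ} {j : Fin n → ℕ} {i : ∀ s, Fin (j s) → ℕ}
    {a : ∀ s t, Fin (i s t) → M.Ob} {b : ∀ s, Fin (j s) → M.Ob} {c : Fin n → M.Ob} {d : M.Ob}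
    (h : M.Hom c d) (g : ∀ s, M.Hom (b s) (c s)) (f : ∀ s t, M.Hom (a s t) (b s t)),
    HEq (M.comp h (fun s => M.comp (g s) (f s)))
      (M.comp (M.comp h g) (fun k : Fin (∑ s, j s) =>
        f (finSigmaFinEquiv.symm k).1 (finSigmaFinEquiv.symm k).2))
  act_comp : ∀ {n : ℕ} {j : Fin n → ℕ} {b : ∀ s, Fin (j s) → M.Ob} {c : Fin n → M.Ob} {d : M.Ob}
    (σ : Equiv.Perm (Fin n)) (g : M.Hom c d) (f : ∀ s, M.Hom (b s) (c s)),
    HEq (M.act (blockPerm σ j) (M.comp g f)) (M.comp (M.act σ g) (fun s => f (σ s)))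
  comp_act : ∀ {n : ℕ} {j : Fin n → ℕ} {b : ∀ s, Fin (j s) → M.Ob} {c : Fin n → M.Ob} {d : M.Ob}
    (τ : ∀ s, Equiv.Perm (Fin (j s))) (g : M.Hom c d) (f : ∀ s, M.Hom (b s) (c s)),
    HEq (M.act (sumPerm τ) (M.comp g f)) (M.comp g (fun s => M.act (τ s) (f s)))

/-- A map of the data of multicategories: a map on objects and maps on the sets of `n`-morphisms. -/
structure MulticatMap (M N : MulticatData.{v, u}) where
  obj : M.Ob → N.Ob
  map : {n : ℕ} → {x : Fin n → M.Ob} → {y : M.Ob} → M.Hom x y → N.Hom (fun i => obj (x i)) (obj y)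

/-- A map preserves identities, symmetric group actions and composition. -/
structure MulticatMap.IsMultifunctor {M N : MulticatData.{v, u}} (F : MulticatMap M N) : Prop where
  map_unit : ∀ a : M.Ob, F.map (M.unit a) = N.unit (F.obj a)
  map_act : ∀ {n : ℕ} {x : Fin n → M.Ob} {y : M.Ob} (σ : Equiv.Perm (Fin n)) (f : M.Hom x y),
    F.map (M.act σ f) = N.act σ (F.map f)
  map_comp : ∀ {n : ℕ} {j : Fin n → ℕ} {x : ∀ s, Fin (j s) → M.Ob} {y : Fin n → M.Ob} {z : M.Ob}
    (g : M.Hom y z) (f : ∀ s, M.Hom (x s) (y s)),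
    F.map (M.comp g f) = N.comp (F.map g) (fun s => F.map (f s))

/-- Multicategories. -/
structure Multicategory where
  data : MulticatData.{v, u}
  isMulticategory : data.IsMulticategory

/-- Multifunctors, the morphisms of multicategories. -/
@[ext]
structure Multifunctor (M N : Multicategory.{v, u}) where
  toMap : MulticatMap M.data N.data
  isMultifunctor : toMap.IsMultifunctor

/-- The category of multicategories and multifunctors. -/
instance : Category Multicategory.{v, u} where
  Hom M N := Multifunctor M N
  id M :=
    { toMap := { obj := fun a => a, map := fun f => f }
      isMultifunctor := ⟨fun _ => rfl, fun _ _ => rfl, fun _ _ => rfl⟩ }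
  comp F G :=
    { toMap :=
        { obj := fun a => G.toMap.obj (F.toMap.obj a)
          map := fun f => G.toMap.map (F.toMap.map f) }
      isMultifunctor :=
        ⟨fun a => (congrArg G.toMap.map (F.isMultifunctor.map_unit a)).trans
            (G.isMultifunctor.map_unit _),
         fun σ f => (congrArg G.toMap.map (F.isMultifunctor.map_act σ f)).trans
            (G.isMultifunctor.map_act σ _),
         fun g f => (congrArg G.toMap.map (F.isMultifunctor.map_comp g f)).trans
            (G.isMultifunctor.map_comp _ _)⟩ }

/-! ## Symmetric monoidal categories and lax symmetric monoidal functors -/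

/-- Symmetric monoidal categories. -/
structure SymMonCat where
  carrier : Type u
  [category : Category.{v} carrier]
  [monoidal : MonoidalCategory carrier]
  [symmetric : SymmetricCategory carrier]

instance : CoeSort SymMonCat.{v, u} (Type u) := ⟨SymMonCat.carrier⟩

attribute [instance] SymMonCat.category SymMonCat.monoidal SymMonCat.symmetric

theorem laxBraided_ext {C D : SymMonCat.{v, u}} (F : C ⥤ D) {h h' : F.LaxBraided}
    (hε : h.ε = h'.ε) (hμ : ∀ X Y, h.μ X Y = h'.μ X Y) :
    @LaxBraidedFunctor.mk C _ _ _ D _ _ _ F h = @LaxBraidedFunctor.mk C _ _ _ D _ _ _ F h' := by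
  obtain @⟨⟨ε, μ, _, _, _, _, _⟩, _⟩ := h
  obtain @⟨⟨ε', μ', _, _, _, _, _⟩, _⟩ := h'
  obtain rfl : ε = ε' := hε
  obtain rfl : μ = μ' := by
    funext X Y
    exact hμ X Y
  rfl

/-- The category of symmetric monoidal categories and lax symmetric monoidal functors. -/
instance : Category SymMonCat.{v, u} where
  Hom C D := LaxBraidedFunctor C D
  id C := LaxBraidedFunctor.of (𝟭 C)
  comp F G := LaxBraidedFunctor.of (F.toFunctor ⋙ G.toFunctor)
  id_comp F := by
    obtain ⟨F, hF⟩ := F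
    refine laxBraided_ext F ?_ fun X Y => ?_
    · exact (congrArg _ (F.map_id _)).trans (Category.comp_id _)
    · exact (congrArg _ (F.map_id _)).trans (Category.comp_id _)
  comp_id F := by
    obtain ⟨F, hF⟩ := F
    refine laxBraided_ext F ?_ fun X Y => ?_
    · exact Category.id_comp _
    · exact Category.id_comp _
  assoc F G H := by
    obtain ⟨F, hF⟩ := F
    obtain ⟨G, hG⟩ := G
    obtain ⟨H, hH⟩ := H
    refine laxBraided_ext (F ⋙ G ⋙ H) ?_ fun X Y => ?_
    · change Functor.LaxMonoidal.ε H ≫ H.map (Functor.LaxMonoidal.ε G ≫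
          G.map (Functor.LaxMonoidal.ε F)) =
        (Functor.LaxMonoidal.ε H ≫ H.map (Functor.LaxMonoidal.ε G)) ≫
          H.map (G.map (Functor.LaxMonoidal.ε F))
      simp
    · change Functor.LaxMonoidal.μ H _ _ ≫ H.map (Functor.LaxMonoidal.μ G _ _ ≫
          G.map (Functor.LaxMonoidal.μ F X Y)) =
        (Functor.LaxMonoidal.μ H _ _ ≫ H.map (Functor.LaxMonoidal.μ G _ _)) ≫
          H.map (G.map (Functor.LaxMonoidal.μ F X Y))
      simp

/-! ## The categorical operad `Y` and its action on symmetric monoidal categories -/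

/-- Complete parenthesizations of nonempty lists, whose slots are filled by variables from `ι` or
by the unit. -/
inductive Tree (ι : Type*) where
  | unit : Tree ι
  | var : ι → Tree ι
  | tensor : Tree ι → Tree ι → Tree ι

namespace Tree

variable {ι ι' : Type*}

/-- The list of the variables of a tree, from left to right. -/
def leaves : Tree ι → List ι
  | unit => []
  | var i => [i]
  | tensor s t => s.leaves ++ t.leaves

/-- Substitution of trees for variables. -/
def bind : Tree ι → (ι → Tree ι') → Tree ι'
  | unit, _ => unit
  | var i, f => f i
  | tensor s t, f => tensor (s.bind f) (t.bind f)

/-- Relabelling of the variables. -/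
def map (f : ι → ι') (t : Tree ι) : Tree ι' := t.bind (fun i => var (f i))

/-- Every variable occurs exactly once. -/
def Linear (t : Tree ι) : Prop := t.leaves.Nodup ∧ ∀ i, i ∈ t.leaves

theorem leaves_bind (t : Tree ι) (f : ι → Tree ι') :
    (t.bind f).leaves = t.leaves.flatMap (fun i => (f i).leaves) := by
  induction t with
  | unit => rfl
  | var i => simp [bind, leaves]
  | tensor s t hs ht => simp [bind, leaves, hs, ht]

theorem leaves_map (t : Tree ι) (f : ι → ι') : (t.map f).leaves = t.leaves.map f := by
  rw [map, leaves_bind]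
  exact List.flatMap_pure_eq_map f t.leaves

theorem Linear.map {t : Tree ι} (ht : t.Linear) (e : ι ≃ ι') : (t.map e).Linear := by
  rw [Linear, leaves_map]
  refine ⟨ht.1.map e.injective, fun i => ?_⟩
  exact List.mem_map.2 ⟨e.symm i, ht.2 _, e.apply_symm_apply i⟩

/-- Formal composites of the structural isomorphisms of a symmetric monoidal category. -/
inductive Word : Tree ι → Tree ι → Type _ where
  | id (s : Tree ι) : Word s s
  | comp {s t r : Tree ι} : Word s t → Word t r → Word s r
  | tensor {s t s' t' : Tree ι} : Word s s' → Word t t' → Word (tensor s t) (tensor s' t')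
  | assoc (s t r : Tree ι) : Word (tensor (tensor s t) r) (tensor s (tensor t r))
  | assocInv (s t r : Tree ι) : Word (tensor s (tensor t r)) (tensor (tensor s t) r)
  | leftUnit (s : Tree ι) : Word (tensor unit s) s
  | leftUnitInv (s : Tree ι) : Word s (tensor unit s)
  | rightUnit (s : Tree ι) : Word (tensor s unit) s
  | rightUnitInv (s : Tree ι) : Word s (tensor s unit)
  | braid (s t : Tree ι) : Word (tensor s t) (tensor t s)

theorem Word.symm {s t : Tree ι} : Word s t → Nonempty (Word t s) := by
  intro w
  induction w with
  | id s => exact ⟨.id s⟩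
  | comp _ _ h h' => exact ⟨.comp h'.some h.some⟩
  | tensor _ _ h h' => exact ⟨.tensor h.some h'.some⟩
  | assoc s t r => exact ⟨.assocInv s t r⟩
  | assocInv s t r => exact ⟨.assoc s t r⟩
  | leftUnit s => exact ⟨.leftUnitInv s⟩
  | leftUnitInv s => exact ⟨.leftUnit s⟩
  | rightUnit s => exact ⟨.rightUnitInv s⟩
  | rightUnitInv s => exact ⟨.rightUnit s⟩
  | braid s t => exact ⟨.braid t s⟩

/-- The right-nested tree with a given list of variables. -/
def ofList : List ι → Tree ι
  | [] => unit
  | i :: l => tensor (var i) (ofList l)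

theorem word_append (l l' : List ι) :
    Nonempty (Word (tensor (ofList l) (ofList l')) (ofList (l ++ l'))) := by
  induction l with
  | nil => exact ⟨.leftUnit _⟩
  | cons i l h => exact ⟨.comp (.assoc _ _ _) (.tensor (.id _) h.some)⟩

theorem word_ofList (t : Tree ι) : Nonempty (Word t (ofList t.leaves)) := by
  induction t with
  | unit => exact ⟨.id _⟩
  | var i => exact ⟨.rightUnitInv _⟩
  | tensor s t hs ht => exact ⟨.comp (.tensor hs.some ht.some) (word_append _ _).some⟩

theorem word_perm {l l' : List ι} (h : l.Perm l') : Nonempty (Word (ofList l) (ofList l')) := by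
  induction h with
  | nil => exact ⟨.id _⟩
  | cons i _ h => exact ⟨.tensor (.id _) h.some⟩
  | swap i k l =>
    exact ⟨.comp (.assocInv _ _ _) (.comp (.tensor (.braid _ _) (.id _)) (.assoc _ _ _))⟩
  | trans _ _ h h' => exact ⟨.comp h.some h'.some⟩

theorem Linear.word {s t : Tree ι} (hs : s.Linear) (ht : t.Linear) : Nonempty (Word s t) := by
  have h : s.leaves.Perm t.leaves :=
    (List.perm_ext_iff_of_nodup hs.1 ht.1).2 fun i => ⟨fun _ => ht.2 i, fun _ => hs.2 i⟩
  obtain ⟨w⟩ := word_ofList t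
  exact ⟨.comp (word_ofList s).some (.comp (word_perm h).some w.symm.some)⟩

variable {C : Type u} [Category.{v} C] [MonoidalCategory C]

/-- The functor `C^ι ⥤ C` given by a tree, on objects. -/
def eval : Tree ι → (ι → C) → C
  | unit, _ => 𝟙_ C
  | var i, x => x i
  | tensor s t, x => s.eval x ⊗ t.eval x

/-- The functor `C^ι ⥤ C` given by a tree, on morphisms. -/
def evalMap : (t : Tree ι) → {x y : ι → C} → (∀ i, x i ⟶ y i) → (t.eval x ⟶ t.eval y)
  | unit, _, _, _ => 𝟙 (𝟙_ C)
  | var i, _, _, f => f i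
  | tensor s t, _, _, f => s.evalMap f ⊗ₘ t.evalMap f

/-- The composite of structural isomorphisms denoted by a formal composite. -/
def Word.eval [SymmetricCategory C] (x : ι → C) : {s t : Tree ι} → Word s t →
    (s.eval x ⟶ t.eval x)
  | _, _, .id s => 𝟙 (s.eval x)
  | _, _, .comp p q => p.eval x ≫ q.eval x
  | _, _, .tensor p q => p.eval x ⊗ₘ q.eval x
  | _, _, .assoc s t r => (α_ (s.eval x) (t.eval x) (r.eval x)).hom
  | _, _, .assocInv s t r => (α_ (s.eval x) (t.eval x) (r.eval x)).inv
  | _, _, .leftUnit s => (λ_ (s.eval x)).hom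
  | _, _, .leftUnitInv s => (λ_ (s.eval x)).inv
  | _, _, .rightUnit s => (ρ_ (s.eval x)).hom
  | _, _, .rightUnitInv s => (ρ_ (s.eval x)).inv
  | _, _, .braid s t => (β_ (s.eval x) (t.eval x)).hom

theorem eval_bind (t : Tree ι) (f : ι → Tree ι') (x : ι' → C) :
    (t.bind f).eval x = t.eval (fun i => (f i).eval x) := by
  induction t with
  | unit => rfl
  | var i => rfl
  | tensor s t hs ht => simp [bind, eval, hs, ht]

theorem eval_map (t : Tree ι) (f : ι → ι') (x : ι' → C) :
    (t.map f).eval x = t.eval (fun i => x (f i)) := eval_bind t _ x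

/-- For a lax monoidal functor `F`, the map `t(F x₁, …, F xₙ) ⟶ F (t(x₁, …, xₙ))` that is built from
the structure maps `η` and `ξ` of `F`, by recursion on the parenthesization `t`. -/
def lax {D : Type u} [Category.{v} D] [MonoidalCategory D] (F : C ⥤ D) [F.LaxMonoidal] :
    (t : Tree ι) → (x : ι → C) → (t.eval (fun i => F.obj (x i)) ⟶ F.obj (t.eval x))
  | unit, _ => Functor.LaxMonoidal.ε F
  | var i, x => 𝟙 (F.obj (x i))
  | tensor s t, x => (lax F s x ⊗ₘ lax F t x) ≫ Functor.LaxMonoidal.μ F (s.eval x) (t.eval x)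

end Tree

/-- The objects of the category `Y(n)`: a complete parenthesization of a list of length at least
`n`, with the `n` variables put, in some order, into `n` distinct slots, and units in the other
slots.  In the category `Y(n)` there is exactly one morphism from any object to any other. -/
def Y (n : ℕ) : Type := {t : Tree (Fin n) // t.Linear}

namespace Y

/-- The operad unit `1 ∈ Y(1)`. -/
def one : Y 1 :=
  ⟨.var 0, by simp [Tree.leaves], fun i => by simp [Tree.leaves, Subsingleton.elim i 0]⟩

/-- The right action of `Σₙ` on `Y(n)`, with `(t · σ)(x) = t(x ∘ σ⁻¹)`. -/
def act {n : ℕ} (t : Y n) (σ : Equiv.Perm (Fin n)) : Y n :=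
  ⟨t.1.map σ.symm, t.2.map σ.symm⟩

/-- The operad composition `γ(t; s₁, …, sₙ)`. -/
def comp {n : ℕ} {j : Fin n → ℕ} (t : Y n) (s : ∀ i, Y (j i)) : Y (∑ i, j i) :=
  ⟨t.1.bind (fun i => (s i).1.map (fun k => finSigmaFinEquiv ⟨i, k⟩)), by
    have hl : ∀ i, ((s i).1.map (fun k => finSigmaFinEquiv (n := j) ⟨i, k⟩)).leaves =
        (s i).1.leaves.map (fun k => finSigmaFinEquiv (n := j) ⟨i, k⟩) :=
      fun i => Tree.leaves_map _ _
    refine ⟨?_, fun k => ?_⟩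
    · rw [Tree.leaves_bind, List.nodup_flatMap]
      refine ⟨fun i _ => ?_, t.2.1.imp fun {a b} hab => ?_⟩
      · rw [hl]
        refine (s i).2.1.map fun k k' h => ?_
        simpa using h
      · simp only [Function.onFun, hl]
        intro k hk hk'
        obtain ⟨p, -, rfl⟩ := List.mem_map.1 hk
        obtain ⟨q, -, hq⟩ := List.mem_map.1 hk'
        exact hab (congrArg Sigma.fst (finSigmaFinEquiv.injective hq)).symm
    · rw [Tree.leaves_bind, List.mem_flatMap]
      refine ⟨(finSigmaFinEquiv.symm k).1, t.2.2 _, ?_⟩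
      rw [hl]
      exact List.mem_map.2 ⟨(finSigmaFinEquiv.symm k).2, (s _).2.2 _, by simp⟩⟩

section Action

variable {C : Type u} [Category.{v} C] [MonoidalCategory C] {n : ℕ}

/-- The value `t(x₁, …, xₙ)` of an object of `Y(n)` at an object of `C^n`. -/
def eval (t : Y n) (x : Fin n → C) : C := t.1.eval x

/-- The value of an object of `Y(n)` at a morphism of `C^n`. -/
def evalMap (t : Y n) {x y : Fin n → C} (f : ∀ i, x i ⟶ y i) : t.eval x ⟶ t.eval y :=
  t.1.evalMap f

/-- The component at `x` of the natural isomorphism by which the unique morphism `s ⟶ t` of `Y(n)`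
acts on a symmetric monoidal category: a composite of structural isomorphisms from `s(x)` to `t(x)`.
The variables occurring exactly once in `s` and `t`, all such composites are equal by the coherence
theorem for symmetric monoidal categories, so the choice of one of them does not matter. -/
noncomputable def canon [SymmetricCategory C] (s t : Y n) (x : Fin n → C) : s.eval x ⟶ t.eval x :=
  Tree.Word.eval x (s.2.word t.2).some

theorem act_eval (t : Y n) (σ : Equiv.Perm (Fin n)) (x : Fin n → C) :
    (t.act σ).eval (x ∘ σ) = t.eval x := by
  refine (Tree.eval_map t.1 σ.symm (x ∘ σ)).trans (congrArg t.1.eval ?_)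
  funext i
  simp

theorem comp_eval {j : Fin n → ℕ} (t : Y n) (s : ∀ i, Y (j i)) (x : ∀ i, Fin (j i) → C) :
    (t.comp s).eval (concat x) = t.eval (fun i => (s i).eval (x i)) := by
  refine (Tree.eval_bind t.1 _ (concat x)).trans (congrArg t.1.eval ?_)
  funext i
  refine (Tree.eval_map (s i).1 _ (concat x)).trans (congrArg (s i).1.eval ?_)
  funext k
  simp only [concat]
  rw [Equiv.symm_apply_apply]

end Action

end Y

/-! ## Underlying multicategories -/

/-- A sequence of functions `κₙ : Ob C^n → Ob Y(n)`, `n ≥ 0`, without further structure. -/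
def Choice (C : SymMonCat.{v, u}) : Type u := (n : ℕ) → (Fin n → C) → Y n

/-- The underlying multicategory `U_κ C` (its data).  Its objects are those of `C`, and its
`n`-morphisms `x ⟶ y` are the morphisms `κₙ(x)(x) ⟶ y` of `C`.  The identities, the symmetric group
actions and the composition are given by the isomorphisms `κ₁(a) ⟶ 1`,
`κₙ(x ∘ σ) ⟶ κₙ(x) · σ` and `κ(x₁ ⊙ ⋯ ⊙ xₙ) ⟶ γ(κ(y); κ(x₁), …, κ(xₙ))` of the operad `Y`. -/
noncomputable def underlyingData (C : SymMonCat.{v, u}) (κ : Choice C) : MulticatData.{v, u} where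
  Ob := C
  Hom {n} x y := (κ n x).eval x ⟶ y
  unit a := Y.canon (κ 1 fun _ => a) Y.one (fun _ => a)
  act {n} x _ σ f :=
    Y.canon (κ n (x ∘ σ)) ((κ n x).act σ) (x ∘ σ) ≫ eqToHom (Y.act_eval (κ n x) σ x) ≫ f
  comp {n} {j} x y _ g f :=
    Y.canon (κ _ (concat x)) ((κ n y).comp fun s => κ (j s) (x s)) (concat x) ≫
      eqToHom (Y.comp_eval (κ n y) (fun s => κ (j s) (x s)) x) ≫ (κ n y).evalMap f ≫ g

/-- The map of underlying multicategories induced by a lax symmetric monoidal functor `F : C ⟶ D`: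
it is `F` on objects, and it sends `f : κₙ(x)(x) ⟶ y` to the composite
`κ'ₙ(F x)(F x) ≅ κₙ(x)(F x) ⟶ F (κₙ(x)(x)) ⟶ F y`. -/
noncomputable def underlyingMap {C D : SymMonCat.{v, u}} (F : C ⟶ D) (κ : Choice C)
    (κ' : Choice D) : MulticatMap (underlyingData C κ) (underlyingData D κ') where
  obj := (LaxBraidedFunctor.toFunctor F).obj
  map {n} x _ f :=
    Y.canon (κ' n fun i => (LaxBraidedFunctor.toFunctor F).obj (x i)) (κ n x)
        (fun i => (LaxBraidedFunctor.toFunctor F).obj (x i)) ≫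
      Tree.lax (LaxBraidedFunctor.toFunctor F) (κ n x).1 x ≫ (LaxBraidedFunctor.toFunctor F).map f

/-- The canonical map `U_κ C ⟶ U_κ' C`: it is the identity on objects, and it sends
`f : κₙ(x)(x) ⟶ y` to the composite `κ'ₙ(x)(x) ≅ κₙ(x)(x) ⟶ y`. -/
noncomputable def changeOfChoice {C : SymMonCat.{v, u}} (κ κ' : Choice C) :
    MulticatMap (underlyingData C κ) (underlyingData C κ') where
  obj := fun a : C => a
  map {n} x _ f := Y.canon (C := C) (κ' n x) (κ n x) x ≫ f

end UnderlyingMulticat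

open UnderlyingMulticat

/-! Everything rests on coherence for symmetric monoidal categories: two formal composites `p`, `q`
from `s` to `t`, where no variable is repeated, have the same value at every tuple. Coherence is
proved semantically, without normal forms of words. Since `C` is symmetric, `⊗ : C × C ⥤ C` is a
strong braided functor, and such functors preserve values of words (`Tree.Word.eval_lax`); so if `p`
and `q` agree at `x` and at `y`, they agree at the entrywise product `x ⊗ y`
(`Tree.Word.eval_tensor_eq`). Up to isomorphism every tuple is a product of tuples with at most one
entry different from the unit. At such a tuple there is exactly one way to discard all units, it is
invertible, and every word respects it (`Tree.Word.eval_comp_collapse`), so `p` and `q` have the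
same value.

Call a morphism canonical (`IsCan`) if it is the value of a word up to equalities of objects.
Canonical morphisms are closed under composition, products and substitution, and by coherence they
are determined by their source and target trees when the source has no repeated variable. After
naturality has moved the given morphisms to the end, each multicategory axiom compares two canonical
morphisms followed by one common morphism. The remaining issue is that the two sources are tuples
over different but equal index sets; `Tree.heq_of_isCan`'s role is played by `heq_of_isCan`, which
indexes the variables of both sides by one type.

For a lax symmetric monoidal `F`, the maps `ξ_t` commute with words and with substitution of trees,
which makes `U F` a multifunctor for arbitrary choices at the source and at the target. An
intermediate choice cancels (`Y.laxMap_laxMap`), so `U G ∘ U F = U (G ∘ F)` whatever the three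
choices are. Taking some of the functors to be identities gives functoriality, the isomorphisms
between choices, their naturality and their coherence. -/

namespace UnderlyingMulticat

/-! ### Structure maps of a lax functor against the structural isomorphisms -/

section LaxMaps

open Functor.LaxMonoidal

variable {C D : Type u} [Category.{v} C] [MonoidalCategory C] [Category.{v} D]
  [MonoidalCategory D] (F : C ⥤ D)

/-- This lemma and those up to `laxMap_braiding` are the cases of the induction in
`Tree.Word.eval_lax`, with the maps `ξ_t` replaced by arbitrary maps into values of `F`. -/
theorem laxMap_tensor [F.LaxMonoidal] {A B A' B' : D} {X Y X' Y' : C} {p : A ⟶ A'}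
    {q : B ⟶ B'} {a' : A' ⟶ F.obj X'} {b' : B' ⟶ F.obj Y'} {a : A ⟶ F.obj X} {b : B ⟶ F.obj Y}
    {f : X ⟶ X'} {g : Y ⟶ Y'} (hp : p ≫ a' = a ≫ F.map f) (hq : q ≫ b' = b ≫ F.map g) :
    (p ⊗ₘ q) ≫ (a' ⊗ₘ b') ≫ μ F _ _ = ((a ⊗ₘ b) ≫ μ F _ _) ≫ F.map (f ⊗ₘ g) := by
  rw [tensorHom_comp_tensorHom_assoc, hp, hq, Category.assoc, ← μ_natural,
    tensorHom_comp_tensorHom_assoc]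

theorem laxMap_associator [F.LaxMonoidal] {A B A' : D} {X Y X' : C} (a : A ⟶ F.obj X)
    (b : B ⟶ F.obj Y) (a' : A' ⟶ F.obj X') :
    (α_ A B A').hom ≫ (a ⊗ₘ ((b ⊗ₘ a') ≫ μ F _ _)) ≫ μ F _ _ =
     ((((a ⊗ₘ b) ≫ μ F _ _) ⊗ₘ a') ≫ μ F _ _) ≫ F.map (α_ X Y X').hom := by
  have h₁ : (((a ⊗ₘ b) ≫ μ F X Y) ⊗ₘ a') = ((a ⊗ₘ b) ⊗ₘ a') ≫ μ F X Y ▷ F.obj X' := by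
    rw [← tensorHom_id, tensorHom_comp_tensorHom, Category.comp_id]
  have h₂ : (a ⊗ₘ ((b ⊗ₘ a') ≫ μ F _ _)) = (a ⊗ₘ (b ⊗ₘ a')) ≫ F.obj X ◁ μ F Y X' := by
    rw [← id_tensorHom, tensorHom_comp_tensorHom, Category.comp_id]
  rw [h₁, h₂]
  simp

theorem laxMap_associator_inv [F.LaxMonoidal] {A B A' : D} {X Y X' : C} (a : A ⟶ F.obj X)
    (b : B ⟶ F.obj Y) (a' : A' ⟶ F.obj X') :
    (α_ A B A').inv ≫ (((a ⊗ₘ b) ≫ μ F _ _) ⊗ₘ a') ≫ μ F _ _ =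
     ((a ⊗ₘ ((b ⊗ₘ a') ≫ μ F _ _)) ≫ μ F _ _) ≫ F.map (α_ X Y X').inv := by
  rw [Iso.inv_comp_eq, ← Category.assoc, laxMap_associator]
  simp [← Functor.map_comp]

theorem laxMap_leftUnitor [F.LaxMonoidal] {A : D} {X : C} (a : A ⟶ F.obj X) :
    (λ_ A).hom ≫ a = ((ε F ⊗ₘ a) ≫ μ F _ _) ≫ F.map (λ_ X).hom := by
  have h : (ε F ⊗ₘ a) = (𝟙_ D) ◁ a ≫ ε F ▷ _ := by simp [MonoidalCategory.tensorHom_def']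
  simp [h]

theorem laxMap_rightUnitor [F.LaxMonoidal] {A : D} {X : C} (a : A ⟶ F.obj X) :
    (ρ_ A).hom ≫ a = ((a ⊗ₘ ε F) ≫ μ F _ _) ≫ F.map (ρ_ X).hom := by
  have h : (a ⊗ₘ ε F) = a ▷ 𝟙_ D ≫ _ ◁ ε F := by simp [MonoidalCategory.tensorHom_def]
  simp [h]

theorem laxMap_leftUnitor_inv [F.LaxMonoidal] {A : D} {X : C} (a : A ⟶ F.obj X) :
    (λ_ A).inv ≫ (ε F ⊗ₘ a) ≫ μ F _ _ = a ≫ F.map (λ_ X).inv := by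
  rw [Iso.inv_comp_eq, ← Category.assoc, laxMap_leftUnitor]
  simp [← Functor.map_comp]

theorem laxMap_rightUnitor_inv [F.LaxMonoidal] {A : D} {X : C} (a : A ⟶ F.obj X) :
    (ρ_ A).inv ≫ (a ⊗ₘ ε F) ≫ μ F _ _ = a ≫ F.map (ρ_ X).inv := by
  rw [Iso.inv_comp_eq, ← Category.assoc, laxMap_rightUnitor]
  simp [← Functor.map_comp]

theorem laxMap_braiding [BraidedCategory C] [BraidedCategory D] [F.LaxBraided] {A B : D} {X Y : C}
    (a : A ⟶ F.obj X) (b : B ⟶ F.obj Y) :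
    (β_ A B).hom ≫ (b ⊗ₘ a) ≫ μ F _ _ = ((a ⊗ₘ b) ≫ μ F _ _) ≫ F.map (β_ X Y).hom := by
  rw [Category.assoc, Functor.LaxBraided.braided, BraidedCategory.braiding_naturality_assoc]

theorem laxMap_comp {E : Type u} [Category.{v} E] [MonoidalCategory E] [F.LaxMonoidal] (G : D ⥤ E)
    [G.LaxMonoidal] {A B : D} {A' B' : E} {X Y : C} (a : A ⟶ F.obj X) (b : B ⟶ F.obj Y)
    (a' : A' ⟶ G.obj A) (b' : B' ⟶ G.obj B) :
    (a' ≫ G.map a ⊗ₘ b' ≫ G.map b) ≫ μ G (F.obj X) (F.obj Y) ≫ G.map (μ F X Y) =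
      ((a' ⊗ₘ b') ≫ μ G A B) ≫ G.map ((a ⊗ₘ b) ≫ μ F X Y) := by
  simp [← tensorHom_comp_tensorHom]

end LaxMaps

/-! ### Naturality of words and of the maps `ξ_t` -/

namespace Tree

section Lax

open Functor.LaxMonoidal

variable {ι : Type*} {C D E : Type u} [Category.{v} C] [MonoidalCategory C]
  [Category.{v} D] [MonoidalCategory D] [Category.{v} E] [MonoidalCategory E]

theorem evalMap_id (t : Tree ι) (x : ι → C) : t.evalMap (fun i => 𝟙 (x i)) = 𝟙 (t.eval x) := by
  induction t with
  | unit => rfl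
  | var i => rfl
  | tensor s t hs ht => simp [evalMap, hs, ht, eval]

theorem evalMap_comp (t : Tree ι) {x y z : ι → C} (f : ∀ i, x i ⟶ y i) (g : ∀ i, y i ⟶ z i) :
    t.evalMap (fun i => f i ≫ g i) = t.evalMap f ≫ t.evalMap g := by
  induction t with
  | unit => exact (Category.comp_id (𝟙 (𝟙_ C))).symm
  | var i => rfl
  | tensor s t hs ht => simp [evalMap, hs, ht, eval]

theorem isIso_evalMap (t : Tree ι) {x y : ι → C} (f : ∀ i, x i ≅ y i) :
    IsIso (t.evalMap fun i => (f i).hom) :=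
  ⟨t.evalMap fun i => (f i).inv, by simp [← evalMap_comp, evalMap_id],
    by simp [← evalMap_comp, evalMap_id]⟩

theorem Word.eval_naturality [SymmetricCategory C] {s t : Tree ι} (w : Word s t) {x y : ι → C}
    (f : ∀ i, x i ⟶ y i) : w.eval x ≫ t.evalMap f = s.evalMap f ≫ w.eval y := by
  induction w with
  | id s => simp [Word.eval]
  | comp p q hp hq => rw [Word.eval, Word.eval, Category.assoc, hq, reassoc_of% hp]
  | tensor p q hp hq =>
    exact (tensorHom_comp_tensorHom _ _ _ _).trans
      ((congrArg₂ _ hp hq).trans (tensorHom_comp_tensorHom _ _ _ _).symm)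
  | assoc s t r => exact (associator_naturality (s.evalMap f) (t.evalMap f) (r.evalMap f)).symm
  | assocInv s t r =>
    exact (associator_inv_naturality (s.evalMap f) (t.evalMap f) (r.evalMap f)).symm
  | leftUnit s =>
    refine (leftUnitor_naturality (s.evalMap f)).symm.trans ?_
    rw [← id_tensorHom]; rfl
  | leftUnitInv s =>
    refine Eq.trans ?_ (leftUnitor_inv_naturality (s.evalMap f)).symm
    rw [← id_tensorHom]; rfl
  | rightUnit s =>
    refine (rightUnitor_naturality (s.evalMap f)).symm.trans ?_
    rw [← tensorHom_id]; rfl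
  | rightUnitInv s =>
    refine Eq.trans ?_ (rightUnitor_inv_naturality (s.evalMap f)).symm
    rw [← tensorHom_id]; rfl
  | braid s t => exact (BraidedCategory.braiding_naturality (s.evalMap f) (t.evalMap f)).symm

theorem lax_naturality (F : C ⥤ D) [F.LaxMonoidal] (t : Tree ι) {x y : ι → C}
    (f : ∀ i, x i ⟶ y i) :
    t.evalMap (fun i => F.map (f i)) ≫ lax F t y = lax F t x ≫ F.map (t.evalMap f) := by
  induction t with
  | unit =>
    exact (Category.id_comp (ε F)).trans
      ((Category.comp_id (ε F)).symm.trans (congrArg (ε F ≫ ·) (F.map_id _).symm))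
  | var i => exact (Category.comp_id (F.map (f i))).trans (Category.id_comp (F.map (f i))).symm
  | tensor s t hs ht =>
    simp only [evalMap, lax, Category.assoc, eval, ← μ_natural]
    simp only [tensorHom_comp_tensorHom_assoc, hs, ht]

theorem lax_id (t : Tree ι) (x : ι → C) : lax (𝟭 C) t x = 𝟙 (t.eval x) := by
  induction t with
  | unit => rfl
  | var i => rfl
  | tensor s t hs ht =>
    rw [lax, hs, ht]
    exact (Category.comp_id _).trans (id_tensorHom_id _ _)

theorem lax_comp (F : C ⥤ D) [F.LaxMonoidal] (G : D ⥤ E) [G.LaxMonoidal] (t : Tree ι)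
    (x : ι → C) :
    lax (F ⋙ G) t x = lax G t (fun i => F.obj (x i)) ≫ G.map (lax F t x) := by
  induction t with
  | unit => rfl
  | var i => exact ((Category.id_comp _).trans (G.map_id _)).symm
  | tensor s t hs ht =>
    rw [lax, hs, ht, comp_μ]
    exact laxMap_comp F G (lax F s x) (lax F t x) _ _

theorem isIso_lax (F : C ⥤ D) [F.LaxMonoidal] (hε : IsIso (ε F)) (hμ : ∀ X Y, IsIso (μ F X Y))
    (t : Tree ι) (x : ι → C) : IsIso (lax F t x) := by
  induction t with
  | unit => exact hε
  | var i => exact inferInstanceAs (IsIso (𝟙 _))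
  | tensor s t hs ht =>
    exact inferInstanceAs (IsIso ((lax F s x ⊗ₘ lax F t x) ≫ μ F _ _))

/-- This is used twice: in the coherence proof, with `F` a projection of `C × C` or the tensor
product, and later for the given lax functors, to show that they induce multifunctors. -/
theorem Word.eval_lax [SymmetricCategory C] [SymmetricCategory D] (F : C ⥤ D) [F.LaxBraided]
    {s t : Tree ι} (w : Word s t) (x : ι → C) :
    w.eval (fun i => F.obj (x i)) ≫ lax F t x = lax F s x ≫ F.map (w.eval x) := by
  induction w with
  | id s => simp [Word.eval]
  | comp p q hp hq => rw [Word.eval, Word.eval, Category.assoc, hq, reassoc_of% hp]; simp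
  | tensor p q hp hq => exact laxMap_tensor F hp hq
  | assoc s t r => exact laxMap_associator F (lax F s x) (lax F t x) (lax F r x)
  | assocInv s t r => exact laxMap_associator_inv F (lax F s x) (lax F t x) (lax F r x)
  | leftUnit s => exact laxMap_leftUnitor F (lax F s x)
  | leftUnitInv s => exact laxMap_leftUnitor_inv F (lax F s x)
  | rightUnit s => exact laxMap_rightUnitor F (lax F s x)
  | rightUnitInv s => exact laxMap_rightUnitor_inv F (lax F s x)
  | braid s t => exact laxMap_braiding F (lax F s x) (lax F t x)

end Lax

end Tree

/-! ### The tensor product as a braided functor -/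

section ProductCategory

variable {C : Type u} [Category.{v} C] [MonoidalCategory C] [SymmetricCategory C]

/-- This is the compatibility of the tensor product functor with braidings. Symmetry is essential:
the two inner crossings have to be replaced by inverse braidings before they cancel. -/
theorem tensorμ_braiding (X₁ X₂ Y₁ Y₂ : C) :
    tensorμ X₁ X₂ Y₁ Y₂ ≫ ((β_ X₁ Y₁).hom ⊗ₘ (β_ X₂ Y₂).hom) =
      (β_ (X₁ ⊗ X₂) (Y₁ ⊗ Y₂)).hom ≫ tensorμ Y₁ Y₂ X₁ X₂ := by
  simp only [tensorμ, Category.assoc, BraidedCategory.braiding_tensor_right_hom,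
    BraidedCategory.braiding_tensor_left_hom]
  simp [MonoidalCategory.tensorHom_def, SymmetricCategory.braiding_swap_eq_inv_braiding Y₁ X₂,
    SymmetricCategory.braiding_swap_eq_inv_braiding Y₂ X₁]

/-- The square of a symmetric monoidal category, with the componentwise braiding. -/
@[reducible]
def symmetricSquare : SymmetricCategory (C × C) where
  braiding X Y := Iso.prod (β_ X.1 Y.1) (β_ X.2 Y.2)
  braiding_naturality_left f Z := by ext <;> simp
  braiding_naturality_right X _ _ f := by ext <;> simp
  hexagon_forward X Y Z := by ext <;> simp
  hexagon_reverse X Y Z := by ext <;> simp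
  symmetry X Y := by ext <;> simp

attribute [local instance] symmetricSquare in
/-- The first projection is a strict braided functor. -/
@[reducible]
def laxBraidedFst : (CategoryTheory.Prod.fst C C).LaxBraided where
  ε := 𝟙 (𝟙_ C)
  μ X Y := 𝟙 (X.1 ⊗ Y.1)

attribute [local instance] symmetricSquare in
/-- The second projection is a strict braided functor. -/
@[reducible]
def laxBraidedSnd : (CategoryTheory.Prod.snd C C).LaxBraided where
  ε := 𝟙 (𝟙_ C)
  μ X Y := 𝟙 (X.2 ⊗ Y.2)

attribute [local instance] symmetricSquare in
/-- The tensor product of a symmetric monoidal category is a braided functor. -/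
@[reducible]
def laxBraidedTensor : (tensor C).LaxBraided where
  braided X Y := tensorμ_braiding X.1 X.2 Y.1 Y.2

end ProductCategory

namespace Tree

/-! ### Transport of coherence along strong functors and isomorphisms -/

section Coherence

variable {ι : Type*} {C : Type u} [Category.{v} C] [MonoidalCategory C] [SymmetricCategory C]

/-- For strong `F` the map `ξ_s` is invertible and can be cancelled on the left in `eval_lax`; in
`eval_map_eq` below, `ξ_t` is cancelled on the right. -/
theorem Word.map_eval_eq {D : Type u} [Category.{v} D] [MonoidalCategory D] [SymmetricCategory D]
    (F : C ⥤ D) [F.LaxBraided] (hε : IsIso (Functor.LaxMonoidal.ε F))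
    (hμ : ∀ X Y, IsIso (Functor.LaxMonoidal.μ F X Y)) {s t : Tree ι} {p q : Word s t} {x : ι → C}
    (h : p.eval (fun i => F.obj (x i)) = q.eval (fun i => F.obj (x i))) :
    F.map (p.eval x) = F.map (q.eval x) := by
  have := isIso_lax F hε hμ s x
  rw [← cancel_epi (lax F s x), ← eval_lax, ← eval_lax, h]

theorem Word.eval_map_eq {D : Type u} [Category.{v} D] [MonoidalCategory D] [SymmetricCategory D]
    (F : C ⥤ D) [F.LaxBraided] (hε : IsIso (Functor.LaxMonoidal.ε F))
    (hμ : ∀ X Y, IsIso (Functor.LaxMonoidal.μ F X Y)) {s t : Tree ι} {p q : Word s t} {x : ι → C}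
    (h : p.eval x = q.eval x) :
    p.eval (fun i => F.obj (x i)) = q.eval (fun i => F.obj (x i)) := by
  have := isIso_lax F hε hμ t x
  rw [← cancel_mono (lax F t x), eval_lax, eval_lax, h]

-- The words are compared at the tuple of pairs `(x i, y i)` in `C × C`: the two projections detect
-- their equality there, and the tensor product functor carries it to `C`.
attribute [local instance] symmetricSquare laxBraidedTensor laxBraidedFst laxBraidedSnd in
theorem Word.eval_tensor_eq {s t : Tree ι} {p q : Word s t} {x y : ι → C}
    (hx : p.eval x = q.eval x) (hy : p.eval y = q.eval y) :
    p.eval (fun i => x i ⊗ y i) = q.eval (fun i => x i ⊗ y i) :=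
  Word.eval_map_eq (MonoidalCategory.tensor C)
    (x := fun i => (x i, y i))
    (inferInstanceAs (IsIso (Functor.LaxMonoidal.ε (MonoidalCategory.tensor C))))
    (fun X Y => inferInstanceAs (IsIso (Functor.LaxMonoidal.μ (MonoidalCategory.tensor C) X Y)))
    (Prod.ext
      (Word.map_eval_eq (CategoryTheory.Prod.fst C C) (inferInstanceAs (IsIso (𝟙 _)))
        (fun _ _ => inferInstanceAs (IsIso (𝟙 _))) hx)
      (Word.map_eval_eq (CategoryTheory.Prod.snd C C) (inferInstanceAs (IsIso (𝟙 _)))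
        (fun _ _ => inferInstanceAs (IsIso (𝟙 _))) hy))

theorem Word.eval_eq_iso {s t : Tree ι} {p q : Word s t} {x y : ι → C} (f : ∀ i, x i ≅ y i)
    (hx : p.eval x = q.eval x) : p.eval y = q.eval y := by
  have := isIso_evalMap s f
  rw [← cancel_epi (s.evalMap fun i => (f i).hom), ← eval_naturality, ← eval_naturality, hx]

end Coherence

/-! ### Coherence when at most one entry is not the unit -/

section Collapse

variable {ι : Type*} {C : Type u} [Category.{v} C] [MonoidalCategory C]

/-- The three associator lemmas correspond to the position of `X` among the three factors.
Naturality strips off `f`, `g`, `h`, and an identity between associators and unitors remains. -/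
theorem associator_tensorHom_left {A B D X : C} (f : A ⟶ X) (g : B ⟶ 𝟙_ C) (h : D ⟶ 𝟙_ C) :
    (α_ A B D).hom ≫ (f ⊗ₘ ((g ⊗ₘ h) ≫ (ρ_ (𝟙_ C)).hom)) ≫ (ρ_ X).hom =
      (((f ⊗ₘ g) ≫ (ρ_ X).hom) ⊗ₘ h) ≫ (ρ_ X).hom := by
  have h₁ : (f ⊗ₘ ((g ⊗ₘ h) ≫ (ρ_ (𝟙_ C)).hom)) = (f ⊗ₘ (g ⊗ₘ h)) ≫ X ◁ (ρ_ (𝟙_ C)).hom := by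
    rw [← id_tensorHom, tensorHom_comp_tensorHom, Category.comp_id]
  have h₂ : (((f ⊗ₘ g) ≫ (ρ_ X).hom) ⊗ₘ h) = ((f ⊗ₘ g) ⊗ₘ h) ≫ (ρ_ X).hom ▷ 𝟙_ C := by
    rw [← tensorHom_id, tensorHom_comp_tensorHom, Category.comp_id]
  rw [h₁, h₂, Category.assoc, ← associator_naturality_assoc, Category.assoc]
  congr 1
  monoidal

theorem associator_tensorHom_middle {A B D X : C} (f : A ⟶ 𝟙_ C) (g : B ⟶ X) (h : D ⟶ 𝟙_ C) :
    (α_ A B D).hom ≫ (f ⊗ₘ ((g ⊗ₘ h) ≫ (ρ_ X).hom)) ≫ (λ_ X).hom =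
      (((f ⊗ₘ g) ≫ (λ_ X).hom) ⊗ₘ h) ≫ (ρ_ X).hom := by
  have h₁ : (f ⊗ₘ ((g ⊗ₘ h) ≫ (ρ_ X).hom)) = (f ⊗ₘ (g ⊗ₘ h)) ≫ 𝟙_ C ◁ (ρ_ X).hom := by
    rw [← id_tensorHom, tensorHom_comp_tensorHom, Category.comp_id]
  have h₂ : (((f ⊗ₘ g) ≫ (λ_ X).hom) ⊗ₘ h) = ((f ⊗ₘ g) ⊗ₘ h) ≫ (λ_ X).hom ▷ 𝟙_ C := by
    rw [← tensorHom_id, tensorHom_comp_tensorHom, Category.comp_id]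
  rw [h₁, h₂, Category.assoc, ← associator_naturality_assoc, Category.assoc]
  congr 1
  monoidal

theorem associator_tensorHom_right {A B D X : C} (f : A ⟶ 𝟙_ C) (g : B ⟶ 𝟙_ C) (h : D ⟶ X) :
    (α_ A B D).hom ≫ (f ⊗ₘ ((g ⊗ₘ h) ≫ (λ_ X).hom)) ≫ (λ_ X).hom =
      (((f ⊗ₘ g) ≫ (ρ_ (𝟙_ C)).hom) ⊗ₘ h) ≫ (λ_ X).hom := by
  have h₁ : (f ⊗ₘ ((g ⊗ₘ h) ≫ (λ_ X).hom)) = (f ⊗ₘ (g ⊗ₘ h)) ≫ 𝟙_ C ◁ (λ_ X).hom := by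
    rw [← id_tensorHom, tensorHom_comp_tensorHom, Category.comp_id]
  have h₂ : (((f ⊗ₘ g) ≫ (ρ_ (𝟙_ C)).hom) ⊗ₘ h) =
      ((f ⊗ₘ g) ⊗ₘ h) ≫ (ρ_ (𝟙_ C)).hom ▷ X := by
    rw [← tensorHom_id, tensorHom_comp_tensorHom, Category.comp_id]
  rw [h₁, h₂, Category.assoc, ← associator_naturality_assoc, Category.assoc]
  congr 1
  monoidal

theorem tensorHom_unitor_unit {A B : C} (f : A ⟶ 𝟙_ C) (g : B ⟶ 𝟙_ C) :
    (f ⊗ₘ g) ≫ (λ_ (𝟙_ C)).hom = (f ⊗ₘ g) ≫ (ρ_ (𝟙_ C)).hom := by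
  rw [unitors_equal]

theorem leftUnitor_hom_comp {A X : C} (f : A ⟶ X) :
    (λ_ A).hom ≫ f = (𝟙 (𝟙_ C) ⊗ₘ f) ≫ (λ_ X).hom := by
  simp

theorem rightUnitor_hom_comp {A X : C} (f : A ⟶ X) :
    (ρ_ A).hom ≫ f = (f ⊗ₘ 𝟙 (𝟙_ C)) ≫ (ρ_ X).hom := by
  simp

theorem braiding_comp_rightUnitor [BraidedCategory C] {A B X : C} (f : A ⟶ 𝟙_ C) (g : B ⟶ X) :
    (β_ A B).hom ≫ (g ⊗ₘ f) ≫ (ρ_ X).hom = (f ⊗ₘ g) ≫ (λ_ X).hom := by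
  rw [← BraidedCategory.braiding_naturality_assoc, braiding_rightUnitor]

theorem braiding_comp_leftUnitor [BraidedCategory C] {A B X : C} (f : A ⟶ X) (g : B ⟶ 𝟙_ C) :
    (β_ A B).hom ≫ (g ⊗ₘ f) ≫ (λ_ X).hom = (f ⊗ₘ g) ≫ (ρ_ X).hom := by
  rw [← BraidedCategory.braiding_naturality_assoc, braiding_leftUnitor]

/-- The object `X` or the unit. -/
def orUnit (X : C) (c : Bool) : C := cond c X (𝟙_ C)

/-- Maps that collapse the value of a tree at a tuple of copies of `X` and of the unit, in which at
most one slot of the tree is filled by `X`, by discarding all units. -/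
inductive Collapse (X : C) (b : ι → Bool) :
    (t : Tree ι) → (c : Bool) → (t.eval (fun i => orUnit X (b i)) ⟶ orUnit X c) → Prop
  | unit : Collapse X b unit false (𝟙 (𝟙_ C))
  | var (i : ι) : Collapse X b (var i) (b i) (𝟙 (orUnit X (b i)))
  | left {s t : Tree ι} {c : Bool} {f : s.eval (fun i => orUnit X (b i)) ⟶ orUnit X c}
      {g : t.eval (fun i => orUnit X (b i)) ⟶ 𝟙_ C} :
      Collapse X b s c f → Collapse X b t false g →
        Collapse X b (tensor s t) c ((f ⊗ₘ g) ≫ (ρ_ (orUnit X c)).hom)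
  | right {s t : Tree ι} {c : Bool} {f : s.eval (fun i => orUnit X (b i)) ⟶ 𝟙_ C}
      {g : t.eval (fun i => orUnit X (b i)) ⟶ orUnit X c} :
      Collapse X b s false f → Collapse X b t c g →
        Collapse X b (tensor s t) c ((f ⊗ₘ g) ≫ (λ_ (orUnit X c)).hom)

namespace Collapse

variable {X : C} {b : ι → Bool}

/-- Hence `c` is determined by the tree. This is what forces `c = false` when both rules for
products apply. -/
theorem any_eq {t : Tree ι} {c : Bool} {f : t.eval (fun i => orUnit X (b i)) ⟶ orUnit X c}
    (h : Collapse X b t c f) : t.leaves.any b = c := by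
  induction h with
  | unit => rfl
  | var i => simp [leaves]
  | left _ _ h h' => simp [leaves, h, h']
  | right _ _ h h' => simp [leaves, h, h']

theorem tensor_iff {s t : Tree ι} {c : Bool}
    {h : (tensor s t).eval (fun i => orUnit X (b i)) ⟶ orUnit X c} :
    Collapse X b (tensor s t) c h ↔
      (∃ f g, Collapse X b s c f ∧ Collapse X b t false g ∧
        h = ((f ⊗ₘ g) ≫ (ρ_ (orUnit X c)).hom)) ∨
      (∃ f g, Collapse X b s false f ∧ Collapse X b t c g ∧
        h = ((f ⊗ₘ g) ≫ (λ_ (orUnit X c)).hom)) := by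
  constructor
  · intro H
    cases H with
    | left hf hg => exact .inl ⟨_, _, hf, hg, rfl⟩
    | right hf hg => exact .inr ⟨_, _, hf, hg, rfl⟩
  · rintro (⟨f, g, hf, hg, rfl⟩ | ⟨f, g, hf, hg, rfl⟩)
    · exact .left hf hg
    · exact .right hf hg

/-- The only ambiguity is a product that can be collapsed both by `left` and by `right`. Then both
factors collapse to the unit, and the two results agree because the left and right unitors of the
unit object coincide. -/
theorem unique {t : Tree ι} {c : Bool} {f g : t.eval (fun i => orUnit X (b i)) ⟶ orUnit X c}
    (hf : Collapse X b t c f) (hg : Collapse X b t c g) : f = g := by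
  induction t generalizing c with
  | unit => cases hf; cases hg; rfl
  | var i => cases hf; cases hg; rfl
  | tensor s t hs ht =>
    have key : ∀ {c : Bool} {f₁ : s.eval (fun i => orUnit X (b i)) ⟶ orUnit X c}
        {f₂ : t.eval (fun i => orUnit X (b i)) ⟶ 𝟙_ C}
        {g₁ : s.eval (fun i => orUnit X (b i)) ⟶ 𝟙_ C}
        {g₂ : t.eval (fun i => orUnit X (b i)) ⟶ orUnit X c},
        Collapse X b s c f₁ → Collapse X b t false f₂ → Collapse X b s false g₁ →
        Collapse X b t c g₂ →
        (f₁ ⊗ₘ f₂) ≫ (ρ_ (orUnit X c)).hom = (g₁ ⊗ₘ g₂) ≫ (λ_ (orUnit X c)).hom := by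
      intro c f₁ f₂ g₁ g₂ hf₁ hf₂ hg₁ hg₂
      obtain rfl : c = false := hf₁.any_eq.symm.trans hg₁.any_eq
      obtain rfl : f₁ = g₁ := hs hf₁ hg₁
      obtain rfl : f₂ = g₂ := ht hf₂ hg₂
      exact congrArg _ unitors_equal.symm
    rcases tensor_iff.1 hf with ⟨f₁, f₂, hf₁, hf₂, rfl⟩ | ⟨f₁, f₂, hf₁, hf₂, rfl⟩ <;>
    rcases tensor_iff.1 hg with ⟨g₁, g₂, hg₁, hg₂, rfl⟩ | ⟨g₁, g₂, hg₁, hg₂, rfl⟩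
    · rw [hs hf₁ hg₁, ht hf₂ hg₂]
    · exact key hf₁ hf₂ hg₁ hg₂
    · exact (key hg₁ hg₂ hf₁ hf₂).symm
    · rw [hs hf₁ hg₁, ht hf₂ hg₂]

theorem isIso {t : Tree ι} {c : Bool} {f : t.eval (fun i => orUnit X (b i)) ⟶ orUnit X c}
    (h : Collapse X b t c f) : IsIso f := by
  induction h with
  | unit => exact inferInstanceAs (IsIso (𝟙 _))
  | var i => exact inferInstanceAs (IsIso (𝟙 _))
  | @left _ _ _ f g _ _ h h' =>
    exact @IsIso.comp_isIso _ _ _ _ _ _ _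
      (@tensor_isIso _ _ _ _ _ _ _ f h g h') _
  | @right _ _ _ f g _ _ h h' =>
    exact @IsIso.comp_isIso _ _ _ _ _ _ _
      (@tensor_isIso _ _ _ _ _ _ _ f h g h') _

/-- If at most one slot holds `X`, then one factor of any product contains units only, so one of the
two product rules applies. -/
theorem exists_of_countP_le (X : C) (b : ι → Bool) (t : Tree ι) (h : t.leaves.countP b ≤ 1) :
    ∃ c f, Collapse X b t c f := by
  have eq_false : ∀ {t : Tree ι} {c : Bool} {f}, t.leaves.countP b = 0 → Collapse X b t c f →
      c = false := by
    intro t c f ht hf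
    rw [← hf.any_eq]
    simpa [List.countP_eq_zero] using ht
  induction t with
  | unit => exact ⟨_, _, .unit⟩
  | var i => exact ⟨_, _, .var i⟩
  | tensor s t hs ht =>
    rw [leaves, List.countP_append] at h
    obtain ⟨c, f, hf⟩ := hs (by omega)
    obtain ⟨d, g, hg⟩ := ht (by omega)
    rcases Nat.eq_zero_or_pos (s.leaves.countP b) with h0 | h0
    · obtain rfl := eq_false h0 hf
      exact ⟨_, _, .right hf hg⟩
    · obtain rfl := eq_false (by omega) hg
      exact ⟨_, _, .left hf hg⟩

end Collapse

variable [SymmetricCategory C]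

/-- Each structural isomorphism commutes with discarding units, so pulling a collapse back along a
word gives a collapse of the source. With `unique`, the result does not depend on the word. -/
theorem Word.eval_comp_collapse {X : C} {b : ι → Bool} {s t : Tree ι} (w : Word s t) {c : Bool}
    {f : t.eval (fun i => orUnit X (b i)) ⟶ orUnit X c} (hf : Collapse X b t c f) :
    Collapse X b s c (w.eval _ ≫ f) := by
  induction w generalizing c with
  | id s => rwa [Word.eval, Category.id_comp]
  | comp p q hp hq =>
    rw [Word.eval, Category.assoc]
    exact hp (hq hf)
  | tensor p q hp hq =>
    rcases Collapse.tensor_iff.1 hf with ⟨f₁, f₂, hf₁, hf₂, rfl⟩ | ⟨f₁, f₂, hf₁, hf₂, rfl⟩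
    · refine Collapse.tensor_iff.2 (.inl ⟨_, _, hp hf₁, hq hf₂, ?_⟩)
      exact tensorHom_comp_tensorHom_assoc _ _ _ _ _
    · refine Collapse.tensor_iff.2 (.inr ⟨_, _, hp hf₁, hq hf₂, ?_⟩)
      exact tensorHom_comp_tensorHom_assoc _ _ _ _ _
  | assoc s t r =>
    rcases Collapse.tensor_iff.1 hf with ⟨f₁, f₂, hf₁, hf₂, rfl⟩ | ⟨f₁, f₂, hf₁, hf₂, rfl⟩ <;>
    rcases Collapse.tensor_iff.1 hf₂ with ⟨g₁, g₂, hg₁, hg₂, rfl⟩ | ⟨g₁, g₂, hg₁, hg₂, rfl⟩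
    · exact Collapse.tensor_iff.2 (.inl ⟨_, _, .left hf₁ hg₁, hg₂,
        associator_tensorHom_left f₁ g₁ g₂⟩)
    -- Both inner factors collapse to the unit here, so the left unitor of the unit may be traded
    -- for the right one.
    · refine Collapse.tensor_iff.2 (.inl ⟨_, _, .left hf₁ hg₁, hg₂, ?_⟩)
      exact (congrArg (fun k => (α_ _ _ _).hom ≫ (f₁ ⊗ₘ k) ≫ (ρ_ (orUnit X c)).hom)
        (tensorHom_unitor_unit g₁ g₂)).trans (associator_tensorHom_left f₁ g₁ g₂)
    · exact Collapse.tensor_iff.2 (.inl ⟨_, _, .right hf₁ hg₁, hg₂,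
        associator_tensorHom_middle f₁ g₁ g₂⟩)
    · exact Collapse.tensor_iff.2 (.inr ⟨_, _, .left hf₁ hg₁, hg₂,
        associator_tensorHom_right f₁ g₁ g₂⟩)
  | assocInv s t r =>
    rcases Collapse.tensor_iff.1 hf with ⟨f₁, f₂, hf₁, hf₂, rfl⟩ | ⟨f₁, f₂, hf₁, hf₂, rfl⟩ <;>
    rcases Collapse.tensor_iff.1 hf₁ with ⟨g₁, g₂, hg₁, hg₂, rfl⟩ | ⟨g₁, g₂, hg₁, hg₂, rfl⟩
    · exact Collapse.tensor_iff.2 (.inl ⟨_, _, hg₁, .left hg₂ hf₂,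
        (Iso.inv_comp_eq _).2 (associator_tensorHom_left g₁ g₂ f₂).symm⟩)
    · exact Collapse.tensor_iff.2 (.inr ⟨_, _, hg₁, .left hg₂ hf₂,
        (Iso.inv_comp_eq _).2 (associator_tensorHom_middle g₁ g₂ f₂).symm⟩)
    · exact Collapse.tensor_iff.2 (.inr ⟨_, _, hg₁, .right hg₂ hf₂,
        (Iso.inv_comp_eq _).2 (associator_tensorHom_right g₁ g₂ f₂).symm⟩)
    · refine Collapse.tensor_iff.2 (.inr ⟨_, _, hg₁, .right hg₂ hf₂,
        (Iso.inv_comp_eq _).2 (Eq.trans ?_ (associator_tensorHom_right g₁ g₂ f₂).symm)⟩)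
      exact congrArg (fun k => (k ⊗ₘ f₂) ≫ (λ_ (orUnit X c)).hom) (tensorHom_unitor_unit g₁ g₂)
  | leftUnit s => exact Collapse.tensor_iff.2 (.inr ⟨_, _, .unit, hf, leftUnitor_hom_comp f⟩)
  | leftUnitInv s =>
    have key : ∀ {f₁ : 𝟙_ C ⟶ 𝟙_ C}
        {f₂ : s.eval (fun i => orUnit X (b i)) ⟶ orUnit X c}, Collapse X b unit false f₁ →
        Collapse X b s c f₂ → Collapse X b s c ((λ_ (s.eval fun i => orUnit X (b i))).inv ≫
          (f₁ ⊗ₘ f₂) ≫ (λ_ (orUnit X c)).hom) := by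
      intro f₁ f₂ hf₁ hf₂
      -- The only collapse of the tree `unit` is the identity.
      cases hf₁.unique .unit
      convert hf₂ using 1
      exact (Iso.inv_comp_eq _).2 (leftUnitor_hom_comp f₂).symm
    rcases Collapse.tensor_iff.1 hf with ⟨f₁, f₂, hf₁, hf₂, rfl⟩ | ⟨f₁, f₂, hf₁, hf₂, rfl⟩
    -- The rule `left` reads `c` off the tree `unit`, so everything collapses to the unit and the
    -- two unitors agree.
    · obtain rfl : false = c := hf₁.any_eq
      have := key hf₁ hf₂
      exact congrArg (fun k => (λ_ _).inv ≫ k) (tensorHom_unitor_unit f₁ f₂) ▸ this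
    · exact key hf₁ hf₂
  | rightUnit s => exact Collapse.tensor_iff.2 (.inl ⟨_, _, hf, .unit, rightUnitor_hom_comp f⟩)
  | rightUnitInv s =>
    have key : ∀ {f₁ : s.eval (fun i => orUnit X (b i)) ⟶ orUnit X c}
        {f₂ : 𝟙_ C ⟶ 𝟙_ C}, Collapse X b s c f₁ →
        Collapse X b unit false f₂ → Collapse X b s c ((ρ_ (s.eval fun i => orUnit X (b i))).inv ≫
          (f₁ ⊗ₘ f₂) ≫ (ρ_ (orUnit X c)).hom) := by
      intro f₁ f₂ hf₁ hf₂
      cases hf₂.unique .unit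
      convert hf₁ using 1
      exact (Iso.inv_comp_eq _).2 (rightUnitor_hom_comp f₁).symm
    rcases Collapse.tensor_iff.1 hf with ⟨f₁, f₂, hf₁, hf₂, rfl⟩ | ⟨f₁, f₂, hf₁, hf₂, rfl⟩
    · exact key hf₁ hf₂
    · obtain rfl : false = c := hf₂.any_eq
      have := key hf₁ hf₂
      exact congrArg (fun k => (ρ_ _).inv ≫ k) (tensorHom_unitor_unit f₁ f₂).symm ▸ this
  | braid s t =>
    rcases Collapse.tensor_iff.1 hf with ⟨f₁, f₂, hf₁, hf₂, rfl⟩ | ⟨f₁, f₂, hf₁, hf₂, rfl⟩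
    · exact Collapse.tensor_iff.2 (.inr ⟨_, _, hf₂, hf₁, braiding_comp_rightUnitor f₂ f₁⟩)
    · exact Collapse.tensor_iff.2 (.inl ⟨_, _, hf₂, hf₁, braiding_comp_leftUnitor f₂ f₁⟩)

/-- Two words agree at tuples with at most one entry different from the unit. -/
theorem Word.eval_orUnit_eq {s t : Tree ι} (p q : Word s t) (X : C) (b : ι → Bool)
    (h : t.leaves.countP b ≤ 1) :
    p.eval (fun i => orUnit X (b i)) = q.eval (fun i => orUnit X (b i)) := by
  obtain ⟨c, f, hf⟩ := Collapse.exists_of_countP_le X b t h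
  have := hf.isIso
  exact (cancel_mono f).1 ((p.eval_comp_collapse hf).unique (q.eval_comp_collapse hf))

/-- **Coherence for symmetric monoidal categories.** -/
theorem Word.eval_eq [Finite ι] {s t : Tree ι} (ht : t.leaves.Nodup) (p q : Word s t)
    (x : ι → C) : p.eval x = q.eval x := by
  classical
  cases nonempty_fintype ι
  -- The entries outside `S` are replaced by the unit, and `S` grows by one variable at a time.
  suffices H : ∀ S : Finset ι, p.eval (fun i => orUnit (x i) (decide (i ∈ S))) =
      q.eval (fun i => orUnit (x i) (decide (i ∈ S))) by
    refine Word.eval_eq_iso (fun i => eqToIso ?_) (H Finset.univ)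
    simp [orUnit]
  intro S
  induction S using Finset.induction_on with
  | empty => exact p.eval_orUnit_eq q (𝟙_ C) (fun _ => false) (by simp)
  | insert i S hi hS =>
    -- The absence of repetitions enters here: the variable `i` fills at most one slot of `t`.
    have h1 := p.eval_orUnit_eq q (x i) (fun k => decide (k = i)) (by
      have := List.nodup_iff_count_le_one.1 ht i
      rw [List.count_eq_countP] at this
      exact this)
    -- The tuple for `insert i S` is the entrywise product of the one concentrated at `i` and the
    -- one for `S`, up to a right unitor at `i` (as `i ∉ S`) and left unitors elsewhere.
    refine Word.eval_eq_iso (fun k => ?_) (Word.eval_tensor_eq h1 hS)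
    by_cases hk : k = i
    · subst hk
      exact (eqToIso (by simp [orUnit, hi])) ≪≫ ρ_ (x k) ≪≫ eqToIso (by simp [orUnit])
    · exact (eqToIso (by simp [orUnit, hk])) ≪≫ λ_ (orUnit (x k) (decide (k ∈ S))) ≪≫
        eqToIso (by simp [orUnit, hk])

end Collapse

/-! ### Substitution of trees, up to equality of objects -/

section Heq

variable {ι ι' : Type*} {C D : Type u} [Category.{v} C]

theorem comp_heq {X Y Z X' Y' Z' : C} {f : X ⟶ Y} {g : Y ⟶ Z} {f' : X' ⟶ Y'} {g' : Y' ⟶ Z'}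
    (hX : X = X') (hY : Y = Y') (hZ : Z = Z') (hf : HEq f f') (hg : HEq g g') :
    HEq (f ≫ g) (f' ≫ g') := by
  subst hX hY hZ
  rw [eq_of_heq hf, eq_of_heq hg]

variable [MonoidalCategory C] [Category.{v} D] [MonoidalCategory D]

theorem tensorHom_heq {X Y Z W X' Y' Z' W' : C} {f : X ⟶ Y} {g : Z ⟶ W} {f' : X' ⟶ Y'}
    {g' : Z' ⟶ W'} (hX : X = X') (hY : Y = Y') (hZ : Z = Z') (hW : W = W') (hf : HEq f f')
    (hg : HEq g g') : HEq (f ⊗ₘ g) (f' ⊗ₘ g') := by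
  subst hX hY hZ hW
  rw [eq_of_heq hf, eq_of_heq hg]

theorem evalMap_heq (t : Tree ι) {x y x' y' : ι → C} {f : ∀ i, x i ⟶ y i}
    {f' : ∀ i, x' i ⟶ y' i} (hx : x = x') (hy : y = y') (h : ∀ i, HEq (f i) (f' i)) :
    HEq (t.evalMap f) (t.evalMap f') := by
  subst hx hy
  obtain rfl : f = f' := funext fun i => eq_of_heq (h i)
  rfl

theorem evalMap_bind (t : Tree ι) (s : ι → Tree ι') {x y : ι' → C} (f : ∀ i, x i ⟶ y i) :
    HEq ((t.bind s).evalMap f) (t.evalMap fun i => (s i).evalMap f) := by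
  induction t with
  | unit => rfl
  | var i => rfl
  | tensor t t' h h' =>
    exact tensorHom_heq (eval_bind t s x) (eval_bind t s y) (eval_bind t' s x) (eval_bind t' s y)
      h h'

/-- The recursion defining `ξ` first builds the maps of the inner trees and then that of the outer
one. The preservation of operadic composition by `U F` depends on this. -/
theorem lax_bind (F : C ⥤ D) [F.LaxMonoidal] (t : Tree ι) (s : ι → Tree ι') (x : ι' → C) :
    HEq (lax F (t.bind s) x)
      (t.evalMap (fun i => lax F (s i) x) ≫ lax F t (fun i => (s i).eval x)) := by
  induction t with
  | unit => exact heq_of_eq (Category.id_comp (Functor.LaxMonoidal.ε F)).symm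
  | var i => exact heq_of_eq (Category.comp_id (lax F (s i) x)).symm
  | tensor t t' h h' =>
    have e := eval_bind t s x
    have e' := eval_bind t' s x
    have d := eval_bind t s (fun i => F.obj (x i))
    have d' := eval_bind t' s (fun i => F.obj (x i))
    refine HEq.trans (b := ((t.evalMap (fun i => lax F (s i) x) ≫
      lax F t (fun i => (s i).eval x)) ⊗ₘ (t'.evalMap (fun i => lax F (s i) x) ≫
      lax F t' (fun i => (s i).eval x))) ≫ Functor.LaxMonoidal.μ F _ _) ?_ ?_
    · refine comp_heq ?_ ?_ ?_ (tensorHom_heq d ?_ d' ?_ h h') ?_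
      all_goals simp only [eval, e, e', d, d']
      congr
    · rw [← tensorHom_comp_tensorHom, Category.assoc]
      rfl

end Heq

/-- A word only permutes variables, so the absence of repetitions passes from its source to its
target. -/
theorem Word.leaves_perm {ι : Type*} {s t : Tree ι} (w : Word s t) :
    s.leaves.Perm t.leaves := by
  induction w with
  | id => rfl
  | comp _ _ h h' => exact h.trans h'
  | tensor _ _ h h' => exact h.append h'
  | assoc => simp [leaves]
  | assocInv => simp [leaves]
  | leftUnit => simp [leaves]
  | leftUnitInv => simp [leaves]
  | rightUnit => simp [leaves]
  | rightUnitInv => simp [leaves]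
  | braid => exact List.perm_append_comm

/-! ### Calculus of canonical morphisms -/

section IsCan

variable {ι ι' : Type*} {C : Type u} [Category.{v} C] [MonoidalCategory C] [SymmetricCategory C]

/-- The morphism `f` is, up to equalities of its source and target, the composite of structural
isomorphisms from `s(x)` to `t(x)` denoted by some word. -/
def IsCan (x : ι → C) (s t : Tree ι) {X Y : C} (f : X ⟶ Y) : Prop :=
  ∃ (hX : X = s.eval x) (hY : t.eval x = Y) (w : Word s t),
    f = eqToHom hX ≫ w.eval x ≫ eqToHom hY

namespace IsCan

variable {x : ι → C} {s t r s' t' : Tree ι} {X Y Z X' Y' : C}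

theorem of_word (w : Word s t) : IsCan x s t (w.eval x) := ⟨rfl, rfl, w, by simp⟩

theorem eqToHom (hX : X = s.eval x) (h : X = Y) : IsCan x s s (eqToHom h) := by
  subst hX h
  exact of_word (.id s)

theorem id (hX : X = s.eval x) : IsCan x s s (𝟙 X) := eqToHom hX rfl

theorem comp {f : X ⟶ Y} {g : Y ⟶ Z} (hf : IsCan x s t f) (hg : IsCan x t r g) :
    IsCan x s r (f ≫ g) := by
  obtain ⟨rfl, rfl, w, rfl⟩ := hf
  obtain ⟨hX, rfl, w', rfl⟩ := hg
  exact ⟨rfl, rfl, .comp w w', by simp [Word.eval]⟩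

theorem tensor {f : X ⟶ Y} {g : X' ⟶ Y'} (hf : IsCan x s t f) (hg : IsCan x s' t' g) :
    IsCan x (.tensor s s') (.tensor t t') (f ⊗ₘ g) := by
  obtain ⟨rfl, rfl, w, rfl⟩ := hf
  obtain ⟨rfl, rfl, w', rfl⟩ := hg
  simp only [eqToHom_refl, Category.comp_id, Category.id_comp]
  exact of_word (x := x) (.tensor w w')

theorem associator (hX : X = s.eval x) (hY : Y = t.eval x) (hZ : Z = r.eval x) :
    IsCan x (.tensor (.tensor s t) r) (.tensor s (.tensor t r)) (α_ X Y Z).hom := by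
  subst hX hY hZ
  exact of_word (.assoc s t r)

theorem associator_inv (hX : X = s.eval x) (hY : Y = t.eval x) (hZ : Z = r.eval x) :
    IsCan x (.tensor s (.tensor t r)) (.tensor (.tensor s t) r) (α_ X Y Z).inv := by
  subst hX hY hZ
  exact of_word (.assocInv s t r)

theorem leftUnitor (hX : X = s.eval x) : IsCan x (.tensor .unit s) s (λ_ X).hom := by
  subst hX
  exact of_word (.leftUnit s)

theorem leftUnitor_inv (hX : X = s.eval x) : IsCan x s (.tensor .unit s) (λ_ X).inv := by
  subst hX
  exact of_word (.leftUnitInv s)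

theorem rightUnitor (hX : X = s.eval x) : IsCan x (.tensor s .unit) s (ρ_ X).hom := by
  subst hX
  exact of_word (.rightUnit s)

theorem rightUnitor_inv (hX : X = s.eval x) : IsCan x s (.tensor s .unit) (ρ_ X).inv := by
  subst hX
  exact of_word (.rightUnitInv s)

theorem braiding (hX : X = s.eval x) (hY : Y = t.eval x) :
    IsCan x (.tensor s t) (.tensor t s) (β_ X Y).hom := by
  subst hX hY
  exact of_word (.braid s t)

theorem comp_eqToHom {f : X ⟶ Y} (hf : IsCan x s t f) (h : Y = Z) :
    IsCan x s t (f ≫ CategoryTheory.eqToHom h) := by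
  subst h
  simpa using hf

/-- Coherence in the form used below: only the two end trees matter, not the route between them. -/
theorem unique [Finite ι] (hs : s.leaves.Nodup) {f g : X ⟶ Y} (hf : IsCan x s t f)
    (hg : IsCan x s t g) : f = g := by
  obtain ⟨rfl, rfl, w, rfl⟩ := hf
  obtain ⟨_, _, w', rfl⟩ := hg
  rw [w.eval_eq (w.leaves_perm.nodup_iff.1 hs) w']

theorem eq_id [Finite ι] (hs : s.leaves.Nodup) {f : X ⟶ X} (hf : IsCan x s s f) : f = 𝟙 X :=
  hf.unique hs (id hf.1)

theorem evalMap {y z : ι' → C} {f : ∀ i, y i ⟶ z i} {p q : ι' → Tree ι}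
    (h : ∀ i, IsCan x (p i) (q i) (f i)) (t : Tree ι') :
    IsCan x (t.bind p) (t.bind q) (t.evalMap f) := by
  induction t with
  | unit => exact of_word (.id _)
  | var i => exact h i
  | tensor s t hs ht => exact hs.tensor ht

theorem bind_word {s t : Tree ι'} (p : ι' → Tree ι) (w : Word s t) :
    IsCan x (s.bind p) (t.bind p) (w.eval fun i => (p i).eval x) := by
  induction w with
  | id s => exact id (eval_bind s p x).symm
  | comp _ _ h h' => exact h.comp h'
  | tensor _ _ h h' => exact h.tensor h'
  | assoc s t r =>
    exact associator (eval_bind s p x).symm (eval_bind t p x).symm (eval_bind r p x).symm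
  | assocInv s t r =>
    exact associator_inv (eval_bind s p x).symm (eval_bind t p x).symm (eval_bind r p x).symm
  | leftUnit s => exact leftUnitor (eval_bind s p x).symm
  | leftUnitInv s => exact leftUnitor_inv (eval_bind s p x).symm
  | rightUnit s => exact rightUnitor (eval_bind s p x).symm
  | rightUnitInv s => exact rightUnitor_inv (eval_bind s p x).symm
  | braid s t => exact braiding (eval_bind s p x).symm (eval_bind t p x).symm

/-- A canonical morphism at a tuple of values of trees is canonical for the grafted trees. Together
with `map`, this brings both sides of an axiom to one set of variables. -/
theorem bind {s t : Tree ι'} (p : ι' → Tree ι) {y : ι' → C} {f : X ⟶ Y} (h : IsCan y s t f)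
    (hy : ∀ i, y i = (p i).eval x) : IsCan x (s.bind p) (t.bind p) f := by
  obtain rfl : y = fun i => (p i).eval x := funext hy
  obtain ⟨rfl, rfl, w, rfl⟩ := h
  simpa using bind_word p w

theorem map {s t : Tree ι'} (e : ι' → ι) {y : ι' → C} {f : X ⟶ Y} (h : IsCan y s t f)
    (hy : ∀ i, y i = x (e i)) : IsCan x (s.map e) (t.map e) f :=
  bind (fun i => Tree.var (e i)) h hy

end IsCan

end IsCan

section Bind

variable {ι ι' ι'' : Type*}

theorem bind_bind (t : Tree ι) (f : ι → Tree ι') (g : ι' → Tree ι'') :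
    (t.bind f).bind g = t.bind fun i => (f i).bind g := by
  induction t with
  | unit => rfl
  | var i => rfl
  | tensor s t hs ht => simp [bind, hs, ht]

theorem bind_var (t : Tree ι) : t.bind var = t := by
  induction t with
  | unit => rfl
  | var i => rfl
  | tensor s t hs ht => simp [bind, hs, ht]

theorem map_id' (t : Tree ι) : t.map (fun i => i) = t := bind_var t

theorem map_map (t : Tree ι) (f : ι → ι') (g : ι' → ι'') : (t.map f).map g = t.map (g ∘ f) :=
  bind_bind t _ _

theorem map_bind (t : Tree ι) (f : ι → Tree ι') (g : ι' → ι'') :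
    (t.bind f).map g = t.bind fun i => (f i).map g := bind_bind t _ _

theorem bind_map (t : Tree ι) (f : ι → ι') (g : ι' → Tree ι'') :
    (t.map f).bind g = t.bind fun i => g (f i) := bind_bind t _ _

end Bind

end Tree

/-! ### The lexicographic order on concatenated tuples -/

section Fin

theorem finSigmaFinEquiv_lt {n : ℕ} {j : Fin n → ℕ} {p q : (s : Fin n) × Fin (j s)}
    (h : p.1 < q.1) : finSigmaFinEquiv p < finSigmaFinEquiv q := by
  rw [Fin.lt_def, finSigmaFinEquiv_apply, finSigmaFinEquiv_apply]
  -- Extending `j` by zero turns both offsets into sums over ranges of natural numbers.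
  let f : ℕ → ℕ := fun i => if h : i < n then j ⟨i, h⟩ else 0
  have hf : ∀ s : Fin n, ∑ i : Fin s, j (Fin.castLE s.2.le i) = ∑ i ∈ Finset.range s, f i := by
    intro s
    rw [Finset.sum_range]
    refine Finset.sum_congr rfl fun i _ => ?_
    have hi : (i : ℕ) < n := i.2.trans s.2
    simp only [f, hi, dif_pos]
    rfl
  have hp : f p.1 = j p.1 := by simp [f]
  -- The block of `p` ends before the block of `q` begins.
  have hle : ∑ i ∈ Finset.range (p.1 + 1), f i ≤ ∑ i ∈ Finset.range q.1, f i :=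
    Finset.sum_le_sum_of_subset (Finset.range_subset_range.2 h)
  rw [Finset.sum_range_succ, hp] at hle
  rw [hf, hf]
  have := p.2.2
  omega

theorem finSigmaFinEquiv_lt_iff {n : ℕ} {j : Fin n → ℕ} (p q : (s : Fin n) × Fin (j s)) :
    finSigmaFinEquiv p < finSigmaFinEquiv q ↔
      p.1 < q.1 ∨ p.1 = q.1 ∧ (p.2 : ℕ) < q.2 := by
  obtain ⟨s, t⟩ := p
  obtain ⟨s', t'⟩ := q
  rcases lt_trichotomy s s' with h | rfl | h
  · simp [h, finSigmaFinEquiv_lt (p := ⟨s, t⟩) (q := ⟨s', t'⟩) h]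
  · rw [Fin.lt_def, finSigmaFinEquiv_apply, finSigmaFinEquiv_apply]
    simp
  · simp [h.not_gt, h.ne', (finSigmaFinEquiv_lt (p := ⟨s', t'⟩) (q := ⟨s, t⟩) h).not_gt]

theorem lt_iff_finSigmaFinEquiv_symm {n : ℕ} {j : Fin n → ℕ} (k l : Fin (∑ s, j s)) :
    k < l ↔ (finSigmaFinEquiv.symm k).1 < (finSigmaFinEquiv.symm l).1 ∨
      (finSigmaFinEquiv.symm k).1 = (finSigmaFinEquiv.symm l).1 ∧
        ((finSigmaFinEquiv.symm k).2 : ℕ) < (finSigmaFinEquiv.symm l).2 := by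
  rw [← finSigmaFinEquiv_lt_iff, Equiv.apply_symm_apply, Equiv.apply_symm_apply]

/-- Two enumerations of the same set in the same order differ by a strictly monotone bijection of
`Fin m`, and the identity is the only one. -/
theorem exists_cast_of_bijective {ι : Type*} {m n : ℕ} {e : Fin m → ι} {d : Fin n → ι}
    (he : e.Bijective) (hd : d.Bijective)
    (h : ∀ k l k' l', e k = d k' → e l = d l' → k < l → k' < l') :
    ∃ h : m = n, ∀ k, e k = d (Fin.cast h k) := by
  let E := (Equiv.ofBijective e he).trans (Equiv.ofBijective d hd).symm
  have hE : ∀ k, d (E k) = e k := fun k => Equiv.ofBijective_apply_symm_apply d hd (e k)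
  obtain rfl : m = n := by simpa using Fintype.card_congr E
  refine ⟨rfl, fun k => ?_⟩
  have hmono : StrictMono E := fun k l hkl => h k l _ _ (hE k).symm (hE l).symm hkl
  have : hmono.orderIsoOfSurjective _ E.surjective = OrderIso.refl _ := Subsingleton.elim _ _
  have hk : E k = k := DFunLike.congr_fun this k
  rw [← hE, hk]
  rfl

theorem concat_finSigmaFinEquiv {n : ℕ} {j : Fin n → ℕ} {A : Type*} (x : ∀ s, Fin (j s) → A)
    (s : Fin n) (t : Fin (j s)) : concat x (finSigmaFinEquiv ⟨s, t⟩) = x s t :=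
  congrArg (fun p : (s : Fin n) × Fin (j s) => x p.1 p.2) (Equiv.symm_apply_apply _ _)

/-- The concatenation of a tuple of tuples of morphisms. -/
def concatHom {n : ℕ} {j : Fin n → ℕ} {C : Type u} [Category.{v} C] {x y : ∀ s, Fin (j s) → C}
    (f : ∀ s t, x s t ⟶ y s t) (k : Fin (∑ s, j s)) : concat x k ⟶ concat y k :=
  f (finSigmaFinEquiv.symm k).1 (finSigmaFinEquiv.symm k).2

end Fin

/-! ### Canonical isomorphisms of the operad and their naturality -/

namespace Y

open UnderlyingMulticat.Tree (IsCan)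

variable {C : Type u} [Category.{v} C] [MonoidalCategory C]

theorem act_evalMap {n : ℕ} (t : Y n) (σ : Equiv.Perm (Fin n)) {x y : Fin n → C}
    (f : ∀ i, x i ⟶ y i) :
    (t.act σ).evalMap (fun i => f (σ i)) ≫ eqToHom (act_eval t σ y) =
      eqToHom (act_eval t σ x) ≫ t.evalMap f := by
  have h : HEq ((t.act σ).evalMap (x := x ∘ σ) (y := y ∘ σ) fun i => f (σ i)) (t.evalMap f) := by
    refine (Tree.evalMap_bind t.1 _ _).trans (Tree.evalMap_heq t.1 ?_ ?_ fun i => ?_)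
    · funext i; simp [Tree.eval]
    · funext i; simp [Tree.eval]
    · change HEq (f (σ (σ.symm i))) (f i)
      rw [Equiv.apply_symm_apply]
  rw [(conj_eqToHom_iff_heq _ _ (act_eval t σ x) (act_eval t σ y)).2 h]
  simp

theorem comp_evalMap {n : ℕ} {j : Fin n → ℕ} (t : Y n) (s : ∀ i, Y (j i))
    {x y : ∀ i, Fin (j i) → C} (f : ∀ i k, x i k ⟶ y i k) :
    (t.comp s).evalMap (concatHom f) ≫
        eqToHom (comp_eval t s y) =
      eqToHom (comp_eval t s x) ≫ t.evalMap (fun i => (s i).evalMap (f i)) := by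
  have h : HEq ((t.comp s).evalMap (concatHom f))
      (t.evalMap (fun i => (s i).evalMap (f i))) := by
    refine (Tree.evalMap_bind t.1 _ _).trans (Tree.evalMap_heq t.1 ?_ ?_ fun i => ?_)
    · funext i; simp [Tree.eval_map, concat_finSigmaFinEquiv, Y.eval]
    · funext i; simp [Tree.eval_map, concat_finSigmaFinEquiv, Y.eval]
    · refine (Tree.evalMap_bind (s i).1 _ _).trans (Tree.evalMap_heq (s i).1 ?_ ?_ fun k => ?_)
      · funext k; simp [Tree.eval, concat_finSigmaFinEquiv]
      · funext k; simp [Tree.eval, concat_finSigmaFinEquiv]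
      · change HEq (f (finSigmaFinEquiv.symm (finSigmaFinEquiv ⟨i, k⟩)).1 _) (f i k)
        rw [Equiv.symm_apply_apply]
  rw [(conj_eqToHom_iff_heq _ _ (comp_eval t s x) (comp_eval t s y)).2 h]
  simp

theorem evalMap_comp {n : ℕ} (t : Y n) {x y z : Fin n → C} (f : ∀ i, x i ⟶ y i)
    (g : ∀ i, y i ⟶ z i) : t.evalMap (fun i => f i ≫ g i) = t.evalMap f ≫ t.evalMap g :=
  Tree.evalMap_comp t.1 f g

variable [SymmetricCategory C]

theorem isCan_canon {n : ℕ} (s t : Y n) (x : Fin n → C) : IsCan x s.1 t.1 (canon s t x) :=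
  IsCan.of_word _

theorem canon_naturality {n : ℕ} (s t : Y n) {x y : Fin n → C} (f : ∀ i, x i ⟶ y i) :
    s.evalMap f ≫ canon s t y = canon s t x ≫ t.evalMap f :=
  (Tree.Word.eval_naturality _ f).symm

/-- The canonical isomorphism from `r(x ∘ σ)` to `t(x) = (t · σ)(x ∘ σ)`. -/
noncomputable def canonAct {n : ℕ} (r t : Y n) (σ : Equiv.Perm (Fin n)) (x : Fin n → C) :
    r.eval (x ∘ σ) ⟶ t.eval x :=
  canon r (t.act σ) (x ∘ σ) ≫ eqToHom (act_eval t σ x)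

theorem isCan_canonAct {n : ℕ} (r t : Y n) (σ : Equiv.Perm (Fin n)) (x : Fin n → C) :
    IsCan (x ∘ σ) r.1 (t.1.map σ.symm) (canonAct r t σ x) :=
  (isCan_canon r (t.act σ) (x ∘ σ)).comp_eqToHom _

theorem canonAct_naturality {n : ℕ} (r t : Y n) (σ : Equiv.Perm (Fin n)) {x y : Fin n → C}
    (f : ∀ i, x i ⟶ y i) :
    r.evalMap (x := x ∘ σ) (y := y ∘ σ) (fun i => f (σ i)) ≫ canonAct r t σ y =
      canonAct r t σ x ≫ t.evalMap f := by
  rw [canonAct, ← Category.assoc, canon_naturality, Category.assoc, act_evalMap, canonAct,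
    Category.assoc]

/-- The canonical isomorphism from `r(x₁ ⊙ ⋯ ⊙ xₙ)` to
`t(s₁(x₁), …, sₙ(xₙ)) = γ(t; s₁, …, sₙ)(x₁ ⊙ ⋯ ⊙ xₙ)`. -/
noncomputable def canonComp {n : ℕ} {j : Fin n → ℕ} (r : Y (∑ i, j i)) (t : Y n)
    (s : ∀ i, Y (j i)) (x : ∀ i, Fin (j i) → C) :
    r.eval (concat x) ⟶ t.eval (fun i => (s i).eval (x i)) :=
  canon r (t.comp s) (concat x) ≫ eqToHom (comp_eval t s x)

theorem isCan_canonComp {n : ℕ} {j : Fin n → ℕ} (r : Y (∑ i, j i)) (t : Y n)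
    (s : ∀ i, Y (j i)) (x : ∀ i, Fin (j i) → C) :
    IsCan (concat x) r.1 (t.1.bind fun i => (s i).1.map fun k => finSigmaFinEquiv ⟨i, k⟩)
      (canonComp r t s x) :=
  (isCan_canon r (t.comp s) (concat x)).comp_eqToHom _

theorem canonComp_naturality {n : ℕ} {j : Fin n → ℕ} (r : Y (∑ i, j i)) (t : Y n)
    (s : ∀ i, Y (j i)) {x y : ∀ i, Fin (j i) → C} (f : ∀ i k, x i k ⟶ y i k) :
    r.evalMap (concatHom f) ≫ canonComp r t s y =
      canonComp r t s x ≫ t.evalMap (fun i => (s i).evalMap (f i)) := by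
  rw [canonComp, ← Category.assoc, canon_naturality, Category.assoc, comp_evalMap, canonComp,
    Category.assoc]

end Y

open UnderlyingMulticat.Tree (IsCan)

theorem Tree.IsCan.congr {ι : Type*} {C : Type u} [Category.{v} C] [MonoidalCategory C]
    [SymmetricCategory C] {x : ι → C} {s t s' t' : Tree ι} {X Y : C} {f : X ⟶ Y}
    (h : IsCan x s t f) (hs : s = s') (ht : t = t') : IsCan x s' t' f := by
  subst hs ht
  exact h

theorem Y.isCan_evalMap {ι : Type*} {C : Type u} [Category.{v} C] [MonoidalCategory C]
    [SymmetricCategory C] {x : ι → C} {n : ℕ} (t : Y n) {y z : Fin n → C} {f : ∀ i, y i ⟶ z i}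
    {p q : Fin n → Tree ι} (h : ∀ i, IsCan x (p i) (q i) (f i)) :
    IsCan x (t.1.bind p) (t.1.bind q) (t.evalMap f) :=
  IsCan.evalMap h t.1

theorem bijective_sigma_fst {n : ℕ} :
    Function.Bijective fun k : Fin (∑ _ : Fin n, 1) => (finSigmaFinEquiv.symm k).1 :=
  (Equiv.bijective (finSigmaFinEquiv.symm.trans
    (Equiv.sigmaUnique (Fin n) fun _ => Fin 1)))

theorem bijective_sigma_snd {n : ℕ} :
    Function.Bijective fun k : Fin (∑ _ : Fin 1, n) => (finSigmaFinEquiv.symm k).2 :=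
  (Equiv.bijective (finSigmaFinEquiv.symm.trans
    ((Equiv.sigmaEquivProd (Fin 1) (Fin n)).trans (Equiv.uniqueProd (Fin n) (Fin 1)))))

theorem comp_comp_comp_eq {C : Type u} [Category.{v} C] {X Y Z W V U : C} (p : X ⟶ Y) {f : Y ⟶ Z}
    {g : Z ⟶ W} {h : Y ⟶ V} {k : V ⟶ W} (e : f ≫ g = h ≫ k) (q : W ⟶ U) :
    p ≫ f ≫ g ≫ q = (p ≫ h) ≫ k ≫ q := by
  rw [reassoc_of% e, Category.assoc]

/-! ### The axioms of a multicategory -/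

section Underlying

variable {C : SymMonCat.{v, u}} (κ : Choice C)

/-- The identities of the underlying multicategory. -/
noncomputable def Choice.unit (a : C) : (κ 1 fun _ => a).eval (fun _ => a) ⟶ a :=
  Y.canon (κ 1 fun _ => a) Y.one (fun _ => a)

/-- The symmetric group actions of the underlying multicategory. -/
noncomputable def Choice.act {n : ℕ} {x : Fin n → C} {y : C} (σ : Equiv.Perm (Fin n))
    (f : (κ n x).eval x ⟶ y) : (κ n (x ∘ σ)).eval (x ∘ σ) ⟶ y :=
  Y.canon (κ n (x ∘ σ)) ((κ n x).act σ) (x ∘ σ) ≫ eqToHom (Y.act_eval (κ n x) σ x) ≫ f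

/-- The composition of the underlying multicategory. -/
noncomputable def Choice.comp {n : ℕ} {j : Fin n → ℕ} {x : ∀ s, Fin (j s) → C} {y : Fin n → C}
    {z : C} (g : (κ n y).eval y ⟶ z) (f : ∀ s, (κ (j s) (x s)).eval (x s) ⟶ y s) :
    (κ (∑ s, j s) (concat x)).eval (concat x) ⟶ z :=
  Y.canon (κ _ (concat x)) ((κ n y).comp fun s => κ (j s) (x s)) (concat x) ≫
    eqToHom (Y.comp_eval (κ n y) (fun s => κ (j s) (x s)) x) ≫ (κ n y).evalMap f ≫ g

variable {κ}

/-- The engine for the axioms stated with `HEq`. The variables of both sources are labelled by one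
set `ι` through `e` and `d`; since the labellings list `ι` in the same order, lengths, tuples and
labellings become equal, and `IsCan.unique` applies. -/
theorem heq_of_isCan {ι : Type*} [Finite ι] {m n : ℕ} {e : Fin m → ι} {d : Fin n → ι}
    (he : e.Bijective) (hd : d.Bijective)
    (hlt : ∀ k l k' l', e k = d k' → e l = d l' → k < l → k' < l') {y : ι → C}
    {x' : Fin m → C} {x : Fin n → C} (hx' : ∀ k, x' k = y (e k)) (hx : ∀ k, x k = y (d k))
    {W z : C} {t : Tree ι}
    {φ' : (κ m x').eval x' ⟶ W} {φ : (κ n x).eval x ⟶ W}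
    (hφ' : IsCan y ((κ m x').1.map e) t φ') (hφ : IsCan y ((κ n x).1.map d) t φ) (g : W ⟶ z) :
    HEq (φ' ≫ g) (φ ≫ g) := by
  obtain ⟨rfl, h⟩ := exists_cast_of_bijective he hd hlt
  obtain rfl : e = d := funext h
  obtain rfl : x' = x := funext fun k => (hx' k).trans (hx k).symm
  rw [hφ'.unique _ hφ]
  rw [Tree.leaves_map]
  exact (κ m x').2.1.map hd.1

theorem Choice.unit_isCan (a : C) :
    IsCan (fun _ : Fin 1 => a) (κ 1 fun _ => a).1 (.var 0) (κ.unit a) :=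
  Y.isCan_canon _ Y.one _

theorem Choice.act_eq {n : ℕ} {x : Fin n → C} {y : C} (σ : Equiv.Perm (Fin n))
    (f : (κ n x).eval x ⟶ y) : κ.act σ f = Y.canonAct (κ n (x ∘ σ)) (κ n x) σ x ≫ f :=
  (Category.assoc _ _ _).symm

theorem Choice.comp_eq {n : ℕ} {j : Fin n → ℕ} {x : ∀ s, Fin (j s) → C} {y : Fin n → C} {z : C}
    (g : (κ n y).eval y ⟶ z) (f : ∀ s, (κ (j s) (x s)).eval (x s) ⟶ y s) :
    κ.comp g f =
      Y.canonComp (κ _ (concat x)) (κ n y) (fun s => κ (j s) (x s)) x ≫ (κ n y).evalMap f ≫ g :=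
  (Category.assoc _ _ _).symm

theorem Choice.act_one {n : ℕ} {x : Fin n → C} {y : C} (f : (κ n x).eval x ⟶ y) :
    κ.act 1 f = f := by
  rw [Choice.act_eq]
  have h := (Y.isCan_canonAct (κ n x) (κ n x) 1 x).congr rfl (Tree.map_id' _)
  exact (congrArg (· ≫ f) (h.eq_id (κ n x).2.1)).trans (Category.id_comp f)

theorem Choice.act_mul {n : ℕ} {x : Fin n → C} {y : C} (σ τ : Equiv.Perm (Fin n))
    (f : (κ n x).eval x ⟶ y) : κ.act (σ * τ) f = κ.act τ (κ.act σ f) := by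
  rw [Choice.act_eq, Choice.act_eq, Choice.act_eq, ← Category.assoc]
  refine congrArg (· ≫ f) ?_
  refine (Y.isCan_canonAct _ _ (σ * τ) x).unique (κ n _).2.1
    ((Y.isCan_canonAct _ (κ n (x ∘ σ)) τ (x ∘ σ)).comp ?_)
  exact ((Y.isCan_canonAct (κ n (x ∘ σ)) (κ n x) σ x).map (x := (x ∘ σ) ∘ τ) τ.symm
    (fun i => by simp)).congr rfl (Tree.map_map _ _ _)

theorem Choice.comp_unit {n : ℕ} {y : Fin n → C} {z : C} (g : (κ n y).eval y ⟶ z) :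
    HEq (κ.comp g (fun s => κ.unit (y s))) g := by
  rw [Choice.comp_eq, ← Category.assoc]
  refine HEq.trans ?_ (heq_of_eq (Category.id_comp g))
  -- All blocks have length one, so a variable is labelled by the number of its block.
  refine heq_of_isCan (y := y) (t := (κ n y).1) bijective_sigma_fst Function.bijective_id ?_
    (fun k => rfl) (fun k => rfl) ?_ ?_ g
  · rintro k l _ _ rfl rfl h
    simpa using (lt_iff_finSigmaFinEquiv_symm k l).1 h
  · have h := (Y.isCan_canonComp (κ _ (concat fun s _ => y s)) (κ n y) (fun s => κ 1 fun _ => y s)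
      (fun s _ => y s)).map (x := y) (fun k => (finSigmaFinEquiv.symm k).1) (fun k => rfl)
    have h' := Y.isCan_evalMap (x := y) (κ n y) (fun s => (Choice.unit_isCan (κ := κ) (y s)).map
      (x := y) (fun _ => s) (fun _ => rfl))
    refine h.comp (h'.congr ?_ (Tree.bind_var _))
    rw [Tree.map_bind]
    refine congrArg _ (funext fun s => ?_)
    rw [Tree.map_map]
    refine congrArg (fun e => Tree.map e _) (funext fun k => ?_)
    simp
  · exact (IsCan.id rfl).congr (Tree.map_id' _).symm rfl

theorem Choice.unit_comp {n : ℕ} {x : Fin n → C} {z : C} (g : (κ n x).eval x ⟶ z) :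
    HEq (κ.comp (κ.unit z) (fun _ : Fin 1 => g)) g := by
  -- Naturality moves `g` behind the canonical isomorphism.
  have e : (κ 1 fun _ => z).evalMap (fun _ => g) ≫ κ.unit z =
      Y.canon (κ 1 fun _ => z) Y.one (fun _ => (κ n x).eval x) ≫ g :=
    Y.canon_naturality (κ 1 fun _ => z) Y.one (fun _ => g)
  rw [Choice.comp_eq, e]
  refine (heq_of_eq (Category.assoc _ _ _).symm).trans
    (HEq.trans ?_ (heq_of_eq (Category.id_comp g)))
  refine heq_of_isCan (y := x) (t := (κ n x).1) bijective_sigma_snd Function.bijective_id ?_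
    (fun k => rfl) (fun k => rfl) ?_ ?_ g
  · rintro k l _ _ rfl rfl h
    have := (lt_iff_finSigmaFinEquiv_symm k l).1 h
    simpa [Subsingleton.elim (finSigmaFinEquiv.symm k).1 (finSigmaFinEquiv.symm l).1] using this
  · have h := (Y.isCan_canonComp (κ _ (concat fun _ => x)) (κ 1 fun _ => z) (fun _ => κ n x)
      (fun _ => x)).map (x := x) (fun k => (finSigmaFinEquiv.symm k).2) (fun k => rfl)
    have h' := (Y.isCan_canon (κ 1 fun _ => z) Y.one (fun _ => (κ n x).eval x)).bind
      (fun _ => (κ n x).1) (fun _ => rfl)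
    refine h.comp (h'.congr ?_ rfl)
    rw [Tree.map_bind]
    refine congrArg _ (funext fun s => ?_)
    rw [Tree.map_map]
    refine (Tree.map_id' _).symm.trans (congrArg (fun e => Tree.map e _) (funext fun k => ?_))
    exact (congrArg (fun p : (_ : Fin 1) × Fin n => p.2)
      (Equiv.symm_apply_apply finSigmaFinEquiv ⟨s, k⟩)).symm
  · exact (IsCan.id rfl).congr (Tree.map_id' _).symm rfl

/-- Both sides are a canonical morphism followed by the same composite of `f`, `g` and `h`. The
variables are labelled by triples `⟨s, t, r⟩`. -/
theorem Choice.assoc {n : ℕ} {j : Fin n → ℕ} {i : ∀ s, Fin (j s) → ℕ}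
    {a : ∀ s t, Fin (i s t) → C} {b : ∀ s, Fin (j s) → C} {c : Fin n → C} {d : C}
    (h : (κ n c).eval c ⟶ d) (g : ∀ s, (κ (j s) (b s)).eval (b s) ⟶ c s)
    (f : ∀ s t, (κ (i s t) (a s t)).eval (a s t) ⟶ b s t) :
    HEq (κ.comp h (fun s => κ.comp (g s) (f s)))
      (κ.comp (κ.comp h g) (fun k : Fin (∑ s, j s) =>
        f (finSigmaFinEquiv.symm k).1 (finSigmaFinEquiv.symm k).2)) := by
  let A : ∀ s, Fin (j s) → C := fun s t => (κ (i s t) (a s t)).eval (a s t)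
  let a' : ∀ k : Fin (∑ s, j s), Fin (i (finSigmaFinEquiv.symm k).1 (finSigmaFinEquiv.symm k).2) →
    C := fun k => a (finSigmaFinEquiv.symm k).1 (finSigmaFinEquiv.symm k).2
  -- On the right-hand side the maps `f` have to pass the isomorphism that belongs to the composite
  -- of `h` and `g`.
  have e : (κ _ (concat b)).evalMap (concatHom f) ≫
        Y.canonComp (κ _ (concat b)) (κ n c) (fun s => κ (j s) (b s)) b =
      Y.canonComp (κ _ (concat b)) (κ n c) (fun s => κ (j s) (b s)) A ≫
        (κ n c).evalMap (fun s => (κ (j s) (b s)).evalMap (f s)) :=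
    Y.canonComp_naturality _ _ _ f
  have hL : κ.comp h (fun s => κ.comp (g s) (f s)) =
      (Y.canonComp (κ _ (concat fun s => concat (a s))) (κ n c) (fun s => κ _ (concat (a s)))
        (fun s => concat (a s)) ≫ (κ n c).evalMap (fun s => Y.canonComp (κ _ (concat (a s)))
          (κ (j s) (b s)) (fun t => κ (i s t) (a s t)) (a s))) ≫
        ((κ n c).evalMap (fun s => (κ (j s) (b s)).evalMap (f s)) ≫ (κ n c).evalMap g ≫ h) := by
    rw [Choice.comp_eq]
    simp only [Choice.comp_eq, Y.evalMap_comp, Category.assoc]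
  have hR : κ.comp (κ.comp h g) (fun k : Fin (∑ s, j s) =>
        f (finSigmaFinEquiv.symm k).1 (finSigmaFinEquiv.symm k).2) =
      (Y.canonComp (κ _ (concat a')) (κ _ (concat b)) (fun k => κ _ (a' k)) a' ≫
        Y.canonComp (κ _ (concat b)) (κ n c) (fun s => κ (j s) (b s)) A) ≫
        ((κ n c).evalMap (fun s => (κ (j s) (b s)).evalMap (f s)) ≫ (κ n c).evalMap g ≫ h) := by
    refine (Choice.comp_eq (x := a') (y := concat b) (κ.comp h g) (concatHom f)).trans ?_
    rw [Choice.comp_eq h g]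
    exact comp_comp_comp_eq _ e _
  refine (heq_of_eq hL).trans (HEq.trans ?_ (heq_of_eq hR.symm))
  let y : ((s : Fin n) × (t : Fin (j s)) × Fin (i s t)) → C := fun p => a p.1 p.2.1 p.2.2
  let E : Fin (∑ s, ∑ t, i s t) → ((s : Fin n) × (t : Fin (j s)) × Fin (i s t)) :=
    fun k => ⟨(finSigmaFinEquiv.symm k).1, finSigmaFinEquiv.symm (finSigmaFinEquiv.symm k).2⟩
  let G : ((k : Fin (∑ s, j s)) ×
      Fin (i (finSigmaFinEquiv.symm k).1 (finSigmaFinEquiv.symm k).2)) →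
      ((s : Fin n) × (t : Fin (j s)) × Fin (i s t)) :=
    fun p => ⟨(finSigmaFinEquiv.symm p.1).1, (finSigmaFinEquiv.symm p.1).2, p.2⟩
  let D : Fin (∑ k : Fin (∑ s, j s), i (finSigmaFinEquiv.symm k).1 (finSigmaFinEquiv.symm k).2) →
      ((s : Fin n) × (t : Fin (j s)) × Fin (i s t)) := fun k => G (finSigmaFinEquiv.symm k)
  have hE : E.Bijective :=
    (finSigmaFinEquiv.symm.trans (Equiv.sigmaCongrRight fun s => finSigmaFinEquiv.symm)).bijective
  have hD : D.Bijective :=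
    (finSigmaFinEquiv.symm.trans ((Equiv.sigmaCongrLeft
      (β := fun p : (s : Fin n) × Fin (j s) => Fin (i p.1 p.2)) finSigmaFinEquiv.symm).trans
      (Equiv.sigmaAssoc fun s t => Fin (i s t)))).bijective
  have hDk : ∀ k r, D (finSigmaFinEquiv ⟨k, r⟩) = G ⟨k, r⟩ :=
    fun k r => congrArg G (Equiv.symm_apply_apply (finSigmaFinEquiv
      (n := fun k : Fin (∑ s, j s) => i (finSigmaFinEquiv.symm k).1 (finSigmaFinEquiv.symm k).2))
      ⟨k, r⟩)
  have hEk : ∀ s t r, E (finSigmaFinEquiv ⟨s, finSigmaFinEquiv ⟨t, r⟩⟩) = ⟨s, t, r⟩ := by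
    intro s t r
    refine (congrArg (fun p : (s : Fin n) × Fin (∑ t, i s t) =>
      (⟨p.1, finSigmaFinEquiv.symm p.2⟩ : (s : Fin n) × (t : Fin (j s)) × Fin (i s t)))
      (Equiv.symm_apply_apply finSigmaFinEquiv _)).trans ?_
    simp
  refine heq_of_isCan (y := y) (e := E) (d := D)
    (t := (κ n c).1.bind fun s => (κ (j s) (b s)).1.bind fun t =>
      (κ (i s t) (a s t)).1.map fun r => ⟨s, t, r⟩)
    hE hD ?_ (fun k => rfl) (fun k => rfl) ?_ ?_ _
  -- One side orders the triples lexicographically as `(s, (t, r))`, the other as `((s, t), r)`;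
  -- these orders coincide.
  · intro k l k' l' hk hl hkl
    obtain ⟨⟨s, k⟩, rfl⟩ := finSigmaFinEquiv.surjective k
    obtain ⟨⟨t, r⟩, rfl⟩ := finSigmaFinEquiv.surjective k
    obtain ⟨⟨s', l⟩, rfl⟩ := finSigmaFinEquiv.surjective l
    obtain ⟨⟨t', r'⟩, rfl⟩ := finSigmaFinEquiv.surjective l
    rw [hEk] at hk hl
    have hq : ∀ {k' s t r}, ⟨s, t, r⟩ = D k' →
        (finSigmaFinEquiv.symm k').1 = finSigmaFinEquiv ⟨s, t⟩ ∧
          ((finSigmaFinEquiv.symm k').2 : ℕ) = r := fun h =>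
      ⟨(Equiv.symm_apply_eq _).1 (congrArg (fun p : (s : Fin n) × (t : Fin (j s)) × Fin (i s t) =>
        (⟨p.1, p.2.1⟩ : (s : Fin n) × Fin (j s))) h.symm),
        (congrArg (fun p : (s : Fin n) × (t : Fin (j s)) × Fin (i s t) => (p.2.2 : ℕ)) h.symm)⟩
    rw [lt_iff_finSigmaFinEquiv_symm, (hq hk).2, (hq hl).2, (hq hk).1, (hq hl).1]
    rw [finSigmaFinEquiv_lt_iff] at hkl ⊢
    rcases hkl with h | ⟨h, h'⟩
    · exact .inl (.inl h)
    · obtain rfl : s = s' := h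
      rw [← Fin.lt_def, finSigmaFinEquiv_lt_iff] at h'
      rcases h' with h' | ⟨h', h''⟩
      · exact .inl (.inr ⟨rfl, h'⟩)
      · obtain rfl : t = t' := h'
        exact .inr ⟨rfl, h''⟩
  · have h₁ := (Y.isCan_canonComp (κ _ (concat fun s => concat (a s))) (κ n c)
      (fun s => κ _ (concat (a s))) (fun s => concat (a s))).map (x := y) E (fun k => rfl)
    have h₂ := Y.isCan_evalMap (x := y) (κ n c)
      (fun s => (Y.isCan_canonComp (κ _ (concat (a s))) (κ (j s) (b s))
        (fun t => κ (i s t) (a s t)) (a s)).map (x := y)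
        (fun k => ⟨s, finSigmaFinEquiv.symm k⟩) (fun k => rfl))
    refine h₁.comp (h₂.congr ?_ ?_)
    · rw [Tree.map_bind]
      refine congrArg _ (funext fun s => ?_)
      rw [Tree.map_map]
      refine congrArg (fun e => Tree.map e _) (funext fun k => ?_)
      obtain ⟨⟨t, r⟩, rfl⟩ := finSigmaFinEquiv.surjective k
      rw [Function.comp, hEk, Equiv.symm_apply_apply]
    · refine congrArg _ (funext fun s => ?_)
      rw [Tree.map_bind]
      refine congrArg _ (funext fun t => ?_)
      rw [Tree.map_map]
      refine congrArg (fun e => Tree.map e _) (funext fun k => ?_)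
      simp
  · have h₁ := (Y.isCan_canonComp (κ _ (concat a')) (κ _ (concat b)) (fun k => κ _ (a' k)) a').map
      (x := y) D (fun k => rfl)
    let T : ((s : Fin n) × Fin (j s)) → Tree ((s : Fin n) × (t : Fin (j s)) × Fin (i s t)) :=
      fun p => (κ (i p.1 p.2) (a p.1 p.2)).1.map fun r => ⟨p.1, p.2, r⟩
    have h₂ := (Y.isCan_canonComp (κ _ (concat b)) (κ n c) (fun s => κ (j s) (b s)) A).bind
      (x := y) (fun k => T (finSigmaFinEquiv.symm k))
      (fun k => (Tree.eval_map (κ _ (a' k)).1 (fun r => (⟨(finSigmaFinEquiv.symm k).1,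
        (finSigmaFinEquiv.symm k).2, r⟩ : (s : Fin n) × (t : Fin (j s)) × Fin (i s t))) y).symm)
    refine h₁.comp (h₂.congr ?_ ?_)
    · rw [Tree.map_bind]
      refine congrArg _ (funext fun k => ?_)
      rw [Tree.map_map]
      exact congrArg (fun e => Tree.map e _) (funext fun r => (hDk k r).symm)
    · rw [Tree.bind_bind]
      refine congrArg _ (funext fun s => ?_)
      rw [Tree.bind_map]
      refine congrArg _ (funext fun t => ?_)
      exact congrArg T (Equiv.symm_apply_apply finSigmaFinEquiv ⟨s, t⟩)

/-- Naturality of the action isomorphism brings `f` behind it; what remains is canonical in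
variables labelled by pairs of a block and a position in it. -/
theorem Choice.act_comp {n : ℕ} {j : Fin n → ℕ} {b : ∀ s, Fin (j s) → C} {c : Fin n → C} {d : C}
    (σ : Equiv.Perm (Fin n)) (g : (κ n c).eval c ⟶ d)
    (f : ∀ s, (κ (j s) (b s)).eval (b s) ⟶ c s) :
    HEq (κ.act (blockPerm σ j) (κ.comp g f)) (κ.comp (κ.act σ g) (fun s => f (σ s))) := by
  have e : (κ n (c ∘ σ)).evalMap (x := (fun s => (κ (j s) (b s)).eval (b s)) ∘ σ) (y := c ∘ σ)
        (fun s => f (σ s)) ≫ Y.canonAct (κ n (c ∘ σ)) (κ n c) σ c =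
      Y.canonAct (κ n (c ∘ σ)) (κ n c) σ (fun s => (κ (j s) (b s)).eval (b s)) ≫
        (κ n c).evalMap f := Y.canonAct_naturality _ _ σ f
  have e' := congrArg (fun k =>
    Y.canonComp (κ _ (concat fun s => b (σ s))) (κ n (c ∘ σ)) (fun s => κ (j (σ s)) (b (σ s)))
      (fun s => b (σ s)) ≫ k ≫ g) e
  rw [Choice.act_eq, Choice.comp_eq, Choice.comp_eq, Choice.act_eq]
  simp only [Category.assoc] at e'
  refine HEq.trans ?_ (heq_of_eq e'.symm)
  refine (heq_of_eq (Category.assoc _ _ _).symm).trans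
    (HEq.trans ?_ (heq_of_eq (Category.assoc _ _ _)))
  have hd : Function.Bijective fun k : Fin (∑ s, j (σ s)) =>
      (⟨σ (finSigmaFinEquiv.symm k).1, (finSigmaFinEquiv.symm k).2⟩ :
        (s : Fin n) × Fin (j s)) :=
    (finSigmaFinEquiv.symm.trans (Equiv.sigmaCongrLeft (β := fun s => Fin (j s)) σ)).bijective
  refine heq_of_isCan (y := fun p : (s : Fin n) × Fin (j s) => b p.1 p.2)
    (e := fun k => finSigmaFinEquiv.symm (blockPerm σ j k))
    (t := (κ n c).1.bind fun s => (κ (j s) (b s)).1.map fun k => ⟨s, k⟩)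
    ((blockPerm σ j).trans finSigmaFinEquiv.symm).bijective hd ?_ (fun k => rfl) (fun k => rfl) ?_ ?_ _
  -- Apart from the cast built into `blockPerm`, which preserves order, the two labellings are the
  -- same.
  · intro k l k' l' hk hl hkl
    have key : ∀ k, finSigmaFinEquiv.symm (blockPerm σ j k) =
        Equiv.sigmaCongrLeft (β := fun s => Fin (j s)) σ
          (finSigmaFinEquiv.symm (finCongr (Equiv.sum_comp σ j).symm k)) :=
      fun k => Equiv.symm_apply_apply _ _
    obtain rfl := hd.1 ((key k).symm.trans hk)
    obtain rfl := hd.1 ((key l).symm.trans hl)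
    exact hkl
  · have h := (Y.isCan_canonAct (κ _ (concat b ∘ blockPerm σ j)) (κ _ (concat b)) (blockPerm σ j)
      (concat b)).map (x := fun p : (s : Fin n) × Fin (j s) => b p.1 p.2)
      (fun k => finSigmaFinEquiv.symm (blockPerm σ j k)) (fun k => rfl)
    have h' := (Y.isCan_canonComp (κ _ (concat b)) (κ n c) (fun s => κ (j s) (b s)) b).map
      (x := fun p : (s : Fin n) × Fin (j s) => b p.1 p.2) finSigmaFinEquiv.symm (fun k => rfl)
    refine h.comp (h'.congr ?_ ?_)
    · rw [Tree.map_map]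
      refine congrArg (fun e => Tree.map e _) (funext fun k => ?_)
      simp
    · rw [Tree.map_bind]
      refine congrArg _ (funext fun s => ?_)
      rw [Tree.map_map]
      refine congrArg (fun e => Tree.map e _) (funext fun k => ?_)
      simp
  · have h := (Y.isCan_canonComp (κ _ (concat fun s => b (σ s))) (κ n (c ∘ σ))
      (fun s => κ (j (σ s)) (b (σ s))) (fun s => b (σ s))).map
      (x := fun p : (s : Fin n) × Fin (j s) => b p.1 p.2)
      (fun k => ⟨σ (finSigmaFinEquiv.symm k).1, (finSigmaFinEquiv.symm k).2⟩) (fun k => rfl)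
    have h' := (Y.isCan_canonAct (κ n (c ∘ σ)) (κ n c) σ
      (fun s => (κ (j s) (b s)).eval (b s))).bind
      (x := fun p : (s : Fin n) × Fin (j s) => b p.1 p.2)
      (fun s => (κ (j (σ s)) (b (σ s))).1.map fun k => ⟨σ s, k⟩)
      (fun s => (Tree.eval_map (κ (j (σ s)) (b (σ s))).1
        (fun k => (⟨σ s, k⟩ : (s : Fin n) × Fin (j s))) (fun p => b p.1 p.2)).symm)
    refine h.comp (h'.congr ?_ ?_)
    · rw [Tree.map_bind]
      refine congrArg _ (funext fun s => ?_)
      rw [Tree.map_map]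
      refine congrArg (fun e => Tree.map e _) (funext fun k => ?_)
      exact (congrArg (fun p : (s : Fin n) × Fin (j (σ s)) =>
        (⟨σ p.1, p.2⟩ : (s : Fin n) × Fin (j s)))
        (Equiv.symm_apply_apply finSigmaFinEquiv ⟨s, k⟩)).symm
    · rw [Tree.bind_map]
      refine congrArg _ (funext fun s => ?_)
      rw [Equiv.apply_symm_apply]

theorem Choice.comp_act {n : ℕ} {j : Fin n → ℕ} {b : ∀ s, Fin (j s) → C} {c : Fin n → C} {d : C}
    (τ : ∀ s, Equiv.Perm (Fin (j s))) (g : (κ n c).eval c ⟶ d)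
    (f : ∀ s, (κ (j s) (b s)).eval (b s) ⟶ c s) :
    HEq (κ.act (sumPerm τ) (κ.comp g f)) (κ.comp g (fun s => κ.act (τ s) (f s))) := by
  simp only [Choice.act_eq, Choice.comp_eq, Y.evalMap_comp]
  refine (heq_of_eq (Category.assoc _ _ _).symm).trans
    (HEq.trans ?_ (heq_of_eq ((Category.assoc _ _ _).trans
      (congrArg _ (Category.assoc _ _ _).symm))))
  have hd : Function.Bijective fun k : Fin (∑ s, j s) =>
      (⟨(finSigmaFinEquiv.symm k).1, τ _ (finSigmaFinEquiv.symm k).2⟩ :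
        (s : Fin n) × Fin (j s)) :=
    (finSigmaFinEquiv.symm.trans (Equiv.sigmaCongrRight τ)).bijective
  refine heq_of_isCan (y := fun p : (s : Fin n) × Fin (j s) => b p.1 p.2)
    (e := fun k => finSigmaFinEquiv.symm (sumPerm τ k))
    (t := (κ n c).1.bind fun s => (κ (j s) (b s)).1.map fun k => ⟨s, k⟩)
    ((sumPerm τ).trans finSigmaFinEquiv.symm).bijective hd ?_ (fun k => rfl) (fun k => rfl) ?_ ?_ _
  · intro k l k' l' hk hl hkl
    have key : ∀ k, finSigmaFinEquiv.symm (sumPerm τ k) =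
        Equiv.sigmaCongrRight τ (finSigmaFinEquiv.symm k) := fun k => Equiv.symm_apply_apply _ _
    obtain rfl := hd.1 ((key k).symm.trans hk)
    obtain rfl := hd.1 ((key l).symm.trans hl)
    exact hkl
  · have h := (Y.isCan_canonAct (κ _ (concat b ∘ sumPerm τ)) (κ _ (concat b)) (sumPerm τ)
      (concat b)).map (x := fun p : (s : Fin n) × Fin (j s) => b p.1 p.2)
      (fun k => finSigmaFinEquiv.symm (sumPerm τ k)) (fun k => rfl)
    have h' := (Y.isCan_canonComp (κ _ (concat b)) (κ n c) (fun s => κ (j s) (b s)) b).map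
      (x := fun p : (s : Fin n) × Fin (j s) => b p.1 p.2) finSigmaFinEquiv.symm (fun k => rfl)
    refine h.comp (h'.congr ?_ ?_)
    · rw [Tree.map_map]
      refine congrArg (fun e => Tree.map e _) (funext fun k => ?_)
      simp
    · rw [Tree.map_bind]
      refine congrArg _ (funext fun s => ?_)
      rw [Tree.map_map]
      refine congrArg (fun e => Tree.map e _) (funext fun k => ?_)
      simp
  · have h := (Y.isCan_canonComp (κ _ (concat fun s => b s ∘ τ s)) (κ n c)
      (fun s => κ (j s) (b s ∘ τ s)) (fun s => b s ∘ τ s)).map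
      (x := fun p : (s : Fin n) × Fin (j s) => b p.1 p.2)
      (fun k => ⟨(finSigmaFinEquiv.symm k).1, τ _ (finSigmaFinEquiv.symm k).2⟩) (fun k => rfl)
    have h' := Y.isCan_evalMap (x := fun p : (s : Fin n) × Fin (j s) => b p.1 p.2) (κ n c)
      (fun s => (Y.isCan_canonAct (κ (j s) (b s ∘ τ s)) (κ (j s) (b s)) (τ s) (b s)).map
        (x := fun p : (s : Fin n) × Fin (j s) => b p.1 p.2) (fun k => ⟨s, τ s k⟩)
        (fun k => rfl))
    refine h.comp (h'.congr ?_ ?_)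
    · rw [Tree.map_bind]
      refine congrArg _ (funext fun s => ?_)
      rw [Tree.map_map]
      refine congrArg (fun e => Tree.map e _) (funext fun k => ?_)
      exact (congrArg (fun p : (s : Fin n) × Fin (j s) =>
        (⟨p.1, τ _ p.2⟩ : (s : Fin n) × Fin (j s)))
        (Equiv.symm_apply_apply finSigmaFinEquiv ⟨s, k⟩)).symm
    · refine congrArg _ (funext fun s => ?_)
      rw [Tree.map_map]
      refine congrArg (fun e => Tree.map e _) (funext fun k => ?_)
      simp

end Underlying

theorem isMulticategory_underlyingData (C : SymMonCat.{v, u}) (κ : Choice C) :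
    (underlyingData C κ).IsMulticategory where
  act_one f := Choice.act_one (κ := κ) f
  act_mul σ τ f := Choice.act_mul (κ := κ) σ τ f
  comp_unit g := Choice.comp_unit (κ := κ) g
  unit_comp g := Choice.unit_comp (κ := κ) g
  assoc h g f := Choice.assoc (κ := κ) h g f
  act_comp σ g f := Choice.act_comp (κ := κ) σ g f
  comp_act τ g f := Choice.comp_act (κ := κ) τ g f

theorem eqToHom_comp_eq_of_heq {C : Type u} [Category.{v} C] {X Y X' Y' : C} {f : X ⟶ Y}
    {f' : X' ⟶ Y'} (hX : X = X') (hY : Y = Y') (h : HEq f f') :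
    eqToHom hX ≫ f' = f ≫ eqToHom hY := by
  subst hX hY
  simp [eq_of_heq h]

/-! ### Lax functors and the operad structure -/

namespace Tree

variable {ι ι' : Type*} {C D : Type u} [Category.{v} C] [MonoidalCategory C]
  [Category.{v} D] [MonoidalCategory D] (F : C ⥤ D) [F.LaxMonoidal]

theorem lax_map (t : Tree ι) (e : ι → ι') (x : ι' → C) :
    HEq (lax F (t.map e) x) (lax F t (fun i => x (e i))) := by
  refine (lax_bind F t _ x).trans (heq_of_eq ?_)
  exact (congrArg (· ≫ lax F t _) (evalMap_id t _)).trans (Category.id_comp _)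

theorem lax_heq (t : Tree ι) {x y : ι → C} (h : x = y) : HEq (lax F t x) (lax F t y) := by
  rw [h]

end Tree

namespace Y

variable {C D E : Type u} [Category.{v} C] [MonoidalCategory C] [SymmetricCategory C]
  [Category.{v} D] [MonoidalCategory D] [SymmetricCategory D]
  [Category.{v} E] [MonoidalCategory E] [SymmetricCategory E]

theorem canon_self {n : ℕ} (s : Y n) (x : Fin n → C) : canon s s x = 𝟙 (s.eval x) :=
  (isCan_canon s s x).eq_id s.2.1

theorem canon_comp {n : ℕ} (s t r : Y n) (x : Fin n → C) :
    canon s t x ≫ canon t r x = canon s r x :=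
  ((isCan_canon s t x).comp (isCan_canon t r x)).unique s.2.1 (isCan_canon s r x)

variable (F : C ⥤ D) [F.LaxBraided] (G : D ⥤ E) [G.LaxBraided]

/-- The map `t(F x₁, …, F xₙ) ⟶ F (t(x₁, …, xₙ))` given by the structure maps of `F`. -/
def lax {n : ℕ} (t : Y n) (x : Fin n → C) : t.eval (fun i => F.obj (x i)) ⟶ F.obj (t.eval x) :=
  Tree.lax F t.1 x

theorem lax_naturality {n : ℕ} (t : Y n) {x y : Fin n → C} (f : ∀ i, x i ⟶ y i) :
    t.evalMap (fun i => F.map (f i)) ≫ lax F t y = lax F t x ≫ F.map (t.evalMap f) :=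
  Tree.lax_naturality F t.1 f

theorem lax_functor_comp {n : ℕ} (t : Y n) (x : Fin n → C) :
    lax (F ⋙ G) t x = lax G t (fun i => F.obj (x i)) ≫ G.map (lax F t x) :=
  Tree.lax_comp F G t.1 x

theorem lax_functor_id {n : ℕ} (t : Y n) (x : Fin n → C) : lax (𝟭 C) t x = 𝟙 (t.eval x) :=
  Tree.lax_id t.1 x

theorem canon_lax {n : ℕ} (s t : Y n) (x : Fin n → C) :
    canon s t (fun i => F.obj (x i)) ≫ lax F t x = lax F s x ≫ F.map (canon s t x) :=
  Tree.Word.eval_lax F _ x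

/-- The map `lax` at a concatenation of tuples. -/
def laxConcat {n : ℕ} {j : Fin n → ℕ} (t : Y (∑ i, j i)) (x : ∀ i, Fin (j i) → C) :
    t.eval (concat fun i k => F.obj (x i k)) ⟶ F.obj (t.eval (concat x)) :=
  lax F t (concat x)

theorem canon_laxConcat {n : ℕ} {j : Fin n → ℕ} (s t : Y (∑ i, j i)) (x : ∀ i, Fin (j i) → C) :
    canon s t (concat fun i k => F.obj (x i k)) ≫ laxConcat F t x =
      laxConcat F s x ≫ F.map (canon s t (concat x)) :=
  canon_lax F s t (concat x)

theorem lax_act {n : ℕ} (t : Y n) (σ : Equiv.Perm (Fin n)) (x : Fin n → C) :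
    eqToHom (act_eval t σ (fun i => F.obj (x i))) ≫ lax F t x =
      lax F (t.act σ) (x ∘ σ) ≫ F.map (eqToHom (act_eval t σ x)) := by
  have h : HEq (lax F (t.act σ) (x ∘ σ)) (lax F t x) :=
    (Tree.lax_map F t.1 _ (x ∘ σ)).trans (Tree.lax_heq F t.1 (by funext i; simp))
  rw [eqToHom_map]
  exact eqToHom_comp_eq_of_heq (act_eval t σ fun i => F.obj (x i))
    (congrArg F.obj (act_eval t σ x)) h

theorem lax_comp {n : ℕ} {j : Fin n → ℕ} (t : Y n) (s : ∀ i, Y (j i)) (x : ∀ i, Fin (j i) → C) :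
    eqToHom (comp_eval t s (fun i k => F.obj (x i k))) ≫
        t.evalMap (fun i => lax F (s i) (x i)) ≫ lax F t (fun i => (s i).eval (x i)) =
      laxConcat F (t.comp s) x ≫ F.map (eqToHom (comp_eval t s x)) := by
  have hx : ∀ i, (fun k => concat x (finSigmaFinEquiv ⟨i, k⟩)) = x i := fun i =>
    funext fun k => concat_finSigmaFinEquiv x i k
  have hs : (fun i => ((s i).1.map fun k => finSigmaFinEquiv ⟨i, k⟩).eval (concat x)) =
      fun i => (s i).eval (x i) := funext fun i =>
    (Tree.eval_map _ _ _).trans (congrArg (s i).1.eval (hx i))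
  have hs' : (fun i => ((s i).1.map fun k => finSigmaFinEquiv ⟨i, k⟩).eval
      (fun k => F.obj (concat x k))) = fun i => (s i).eval (fun k => F.obj (x i k)) :=
    funext fun i => (Tree.eval_map _ _ _).trans
      (congrArg (fun y => (s i).1.eval fun k => F.obj (y k)) (hx i))
  have h : HEq (laxConcat F (t.comp s) x)
      (t.evalMap (fun i => lax F (s i) (x i)) ≫ lax F t (fun i => (s i).eval (x i))) := by
    refine (Tree.lax_bind F t.1 _ (concat x)).trans ?_
    refine Tree.comp_heq (congrArg t.1.eval hs') (congrArg (fun y => t.1.eval fun i =>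
      F.obj (y i)) hs) (congrArg (fun y => F.obj (t.1.eval y)) hs)
      (Tree.evalMap_heq t.1 hs' (congrArg (fun y i => F.obj (y i)) hs) fun i => ?_)
      (Tree.lax_heq F t.1 hs)
    exact (Tree.lax_map F (s i).1 _ (concat x)).trans (Tree.lax_heq F (s i).1 (hx i))
  rw [eqToHom_map]
  exact eqToHom_comp_eq_of_heq (comp_eval t s fun i k => F.obj (x i k))
    (congrArg F.obj (comp_eval t s x)) h

theorem canonAct_lax {n : ℕ} (r t : Y n) (σ : Equiv.Perm (Fin n)) (x : Fin n → C) :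
    canonAct r t σ (fun i => F.obj (x i)) ≫ lax F t x =
      lax F r (x ∘ σ) ≫ F.map (canonAct r t σ x) := by
  have h := canon_lax F r (t.act σ) (x ∘ σ)
  rw [canonAct, canonAct, Category.assoc, lax_act, Functor.map_comp, ← Category.assoc,
    ← Category.assoc, ← h]
  rfl

theorem canonComp_lax {n : ℕ} {j : Fin n → ℕ} (r : Y (∑ i, j i)) (t : Y n)
    (s : ∀ i, Y (j i)) (x : ∀ i, Fin (j i) → C) :
    canonComp r t s (fun i k => F.obj (x i k)) ≫ t.evalMap (fun i => lax F (s i) (x i)) ≫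
        lax F t (fun i => (s i).eval (x i)) =
      laxConcat F r x ≫ F.map (canonComp r t s x) := by
  rw [canonComp, canonComp, Category.assoc, lax_comp, Functor.map_comp,
    ← reassoc_of% canon_laxConcat F r (t.comp s) x]

/-- The composite `r(F x₁, …, F xₙ) ≅ s(F x₁, …, F xₙ) ⟶ F (s(x₁, …, xₙ)) ⟶ F y`. -/
noncomputable def laxMap {n : ℕ} (r s : Y n) {x : Fin n → C} {y : C} (f : s.eval x ⟶ y) :
    r.eval (fun i => F.obj (x i)) ⟶ F.obj y :=
  canon r s (fun i => F.obj (x i)) ≫ lax F s x ≫ F.map f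

/-- Since `ξ` commutes with canonical isomorphisms, the intermediate tree `s` drops out. This is why
the choices do not affect composites of the induced maps. -/
theorem laxMap_canon {n : ℕ} (r s t : Y n) {x : Fin n → C} {y : C} (f : t.eval x ⟶ y) :
    laxMap F r s (canon s t x ≫ f) = laxMap F r t f := by
  rw [laxMap, laxMap, Functor.map_comp, ← reassoc_of% canon_lax F s t x, ← canon_comp r s t,
    Category.assoc]

/-- By `laxMap_canon` the tree `s` may be replaced by the single variable, where `ξ` is an identity.
-/
theorem laxMap_canon_one (r s : Y 1) (a : C) :
    laxMap F r s (canon s one fun _ => a) = canon r one fun _ => F.obj a := by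
  rw [← Category.comp_id (canon s one fun _ => a), laxMap_canon, laxMap]
  exact (congrArg (canon r one (fun _ => F.obj a) ≫ ·) ((congrArg (𝟙 (F.obj a) ≫ ·)
    (F.map_id a)).trans (Category.comp_id _))).trans (Category.comp_id _)

theorem laxMap_canonAct {n : ℕ} (r s r' s' : Y n) (σ : Equiv.Perm (Fin n)) {x : Fin n → C} {y : C}
    (f : s.eval x ⟶ y) :
    laxMap F r r' (canonAct r' s σ x ≫ f) =
      canonAct r s' σ (fun i => F.obj (x i)) ≫ laxMap F s' s f := by
  have e : canon r r' ((fun i => F.obj (x i)) ∘ σ) ≫ canonAct r' s σ (fun i => F.obj (x i)) =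
      canonAct r s' σ (fun i => F.obj (x i)) ≫ canon s' s _ := by
    refine ((isCan_canon _ _ _).comp (isCan_canonAct _ _ σ _)).unique r.2.1
      ((isCan_canonAct r s' σ fun i => F.obj (x i)).comp
        ((isCan_canon s' s fun i => F.obj (x i)).map _ fun i => ?_))
    simp
  rw [laxMap, laxMap, Functor.map_comp, ← reassoc_of% canonAct_lax F, ← reassoc_of% e]
  rfl

theorem laxMap_canonComp {n : ℕ} {j : Fin n → ℕ} (r r' : Y (∑ i, j i)) (t t' : Y n)
    (s s' : ∀ i, Y (j i)) {x : ∀ i, Fin (j i) → C} {y : Fin n → C} {z : C} (g : t.eval y ⟶ z)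
    (f : ∀ i, (s i).eval (x i) ⟶ y i) :
    laxMap F r r' (canonComp r' t s x ≫ t.evalMap f ≫ g) =
      canonComp r t' s' (fun i k => F.obj (x i k)) ≫
        t'.evalMap (fun i => laxMap F (s' i) (s i) (f i)) ≫ laxMap F t' t g := by
  -- Both sides are canonical from `r` to the composite of `t` and the `s i`; the second passes
  -- through the choices `t'` and `s'` made in `D`.
  have e : canon r r' (concat fun i k => F.obj (x i k)) ≫
        canonComp r' t s (fun i k => F.obj (x i k)) =
      canonComp r t' s' (fun i k => F.obj (x i k)) ≫
        canon t' t (fun i => (s' i).eval fun k => F.obj (x i k)) ≫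
          t.evalMap (fun i => canon (s' i) (s i) fun k => F.obj (x i k)) := by
    have h₁ := (isCan_canon t' t (fun i => (s' i).eval fun k => F.obj (x i k))).bind
      (x := concat fun i k => F.obj (x i k)) (fun i => (s' i).1.map fun k => finSigmaFinEquiv ⟨i, k⟩)
      (fun i => (congrArg (s' i).1.eval
        (funext fun k => concat_finSigmaFinEquiv (fun i k => F.obj (x i k)) i k)).symm.trans
          (Tree.eval_map (s' i).1 _ _).symm)
    have h₂ := isCan_evalMap (x := concat fun i k => F.obj (x i k)) t (fun i =>
      (isCan_canon (s' i) (s i) fun k => F.obj (x i k)).map (fun k => finSigmaFinEquiv ⟨i, k⟩)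
        fun k => (concat_finSigmaFinEquiv (fun i k => F.obj (x i k)) i k).symm)
    exact ((isCan_canon _ _ _).comp (isCan_canonComp _ _ _ _)).unique r.2.1
      ((isCan_canonComp r t' s' _).comp (h₁.comp h₂))
  have hL : laxMap F r r' (canonComp r' t s x ≫ t.evalMap f ≫ g) =
      canon r r' (concat fun i k => F.obj (x i k)) ≫ laxConcat F r' x ≫
        F.map (canonComp r' t s x ≫ t.evalMap f ≫ g) := rfl
  rw [hL]
  simp only [Functor.map_comp, laxMap, evalMap_comp, Category.assoc]
  -- The maps `ξ` pass the composition isomorphism, the choices are changed by `e`, and naturality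
  -- sorts the factors belonging to `f` and to `g`.
  rw [← reassoc_of% canonComp_lax F r' t s x, reassoc_of% e, ← reassoc_of% lax_naturality F t f,
    ← reassoc_of% canon_naturality t' t (fun i => canon (s' i) (s i) fun k => F.obj (x i k)),
    ← reassoc_of% canon_naturality t' t (fun i => lax F (s i) (x i)),
    ← reassoc_of% canon_naturality t' t (fun i => F.map (f i))]

theorem laxMap_id {n : ℕ} (r s : Y n) {x : Fin n → C} {y : C} (f : s.eval x ⟶ y) :
    laxMap (𝟭 C) r s f = canon r s x ≫ f := by
  rw [laxMap, lax_functor_id]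
  exact congrArg _ (Category.id_comp f)

theorem laxMap_laxMap {n : ℕ} (r s t : Y n) {x : Fin n → C} {y : C} (f : t.eval x ⟶ y) :
    laxMap G r s (laxMap F s t f) = laxMap (F ⋙ G) r t f := by
  refine (laxMap_canon G r s t _).trans ?_
  rw [laxMap, laxMap, lax_functor_comp, Functor.map_comp]
  exact congrArg _ (Category.assoc _ _ _).symm

end Y

/-! ### Functoriality for independent choices -/

section Map

variable {C D E : SymMonCat.{v, u}}

theorem isMultifunctor_underlyingMap (F : C ⟶ D) (κ : Choice C) (κ' : Choice D) :
    (underlyingMap F κ κ').IsMultifunctor where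
  map_unit (a : C) := Y.laxMap_canon_one (LaxBraidedFunctor.toFunctor F) _ (κ 1 fun _ => a) a
  map_act {n x _} σ f :=
    (congrArg (Y.laxMap (LaxBraidedFunctor.toFunctor F) _ _) (Choice.act_eq (κ := κ) σ f)).trans
      ((Y.laxMap_canonAct (LaxBraidedFunctor.toFunctor F) _ (κ n x) (κ n (x ∘ σ)) _ σ f).trans
        (Choice.act_eq (κ := κ') σ _).symm)
  map_comp {n j x y _} g f :=
    (congrArg (Y.laxMap (LaxBraidedFunctor.toFunctor F) _ _) (Choice.comp_eq (κ := κ) g f)).trans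
      ((Y.laxMap_canonComp (LaxBraidedFunctor.toFunctor F) _ (κ _ (concat x)) (κ n y) _
        (fun s => κ (j s) (x s)) _ g f).trans (Choice.comp_eq (κ := κ') _ _).symm)

/-- The underlying multicategory. -/
noncomputable def underlying (C : SymMonCat.{v, u}) (κ : Choice C) : Multicategory.{v, u} where
  data := underlyingData C κ
  isMulticategory := isMulticategory_underlyingData C κ

/-- The multifunctor induced by a lax symmetric monoidal functor. -/
noncomputable def underlyingFunctor (F : C ⟶ D) (κ : Choice C) (κ' : Choice D) :
    underlying C κ ⟶ underlying D κ' where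
  toMap := underlyingMap F κ κ'
  isMultifunctor := isMultifunctor_underlyingMap F κ κ'

/-- The choices at the three categories are independent, so this one identity contains
functoriality, invertibility and naturality of the change of choice, and its coherence. -/
theorem underlyingFunctor_comp (F : C ⟶ D) (G : D ⟶ E) (κ : Choice C) (κ' : Choice D)
    (κ'' : Choice E) :
    underlyingFunctor F κ κ' ≫ underlyingFunctor G κ' κ'' = underlyingFunctor (F ≫ G) κ κ'' := by
  refine Multifunctor.ext (congrArg (MulticatMap.mk _) ?_)
  funext n x y f
  exact Y.laxMap_laxMap (LaxBraidedFunctor.toFunctor F) (LaxBraidedFunctor.toFunctor G)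
    (κ'' n _) (κ' n _) (κ n x) f

/-- A change of choice is the map induced by the identity functor, with different choices at its two
ends. -/
theorem underlyingMap_id (κ κ' : Choice C) : underlyingMap (𝟙 C) κ κ' = changeOfChoice κ κ' := by
  refine congrArg (MulticatMap.mk _) ?_
  funext n x y f
  exact Y.laxMap_id (κ' n x) (κ n x) f

theorem underlyingFunctor_id (κ : Choice C) : underlyingFunctor (𝟙 C) κ κ = 𝟙 _ := by
  refine Multifunctor.ext ((underlyingMap_id κ κ).trans (congrArg (MulticatMap.mk _) ?_))
  funext n x y f
  exact (congrArg (· ≫ f) (Y.canon_self (C := C) (κ n x) x)).trans (Category.id_comp f)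

/-- The multicategory isomorphism between the underlying multicategories for two choices. -/
noncomputable def underlyingIso (κ κ' : Choice C) : underlying C κ ≅ underlying C κ' where
  hom := underlyingFunctor (𝟙 C) κ κ'
  inv := underlyingFunctor (𝟙 C) κ' κ
  hom_inv_id := by rw [underlyingFunctor_comp, Category.comp_id, underlyingFunctor_id]
  inv_hom_id := by rw [underlyingFunctor_comp, Category.comp_id, underlyingFunctor_id]

end Map

/-! ### The functor on a category over symmetric monoidal categories -/

section Functor

variable {T : Type*} [Category T] (P : T ⥤ SymMonCat.{v, u})

/-- The underlying multicategory functor of a category of symmetric monoidal categories. -/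
noncomputable def underlyingMulticategory (κ : ∀ c : T, Choice (P.obj c)) :
    T ⥤ Multicategory.{v, u} where
  obj c := underlying (P.obj c) (κ c)
  map {c d} f := underlyingFunctor (P.map f) (κ c) (κ d)
  map_id c := by rw [P.map_id, underlyingFunctor_id]
  map_comp f g := by rw [P.map_comp, underlyingFunctor_comp]

/-- The natural isomorphism between the underlying multicategory functors for two choices. -/
noncomputable def underlyingMulticategoryIso (κ κ' : ∀ c : T, Choice (P.obj c)) :
    underlyingMulticategory P κ ≅ underlyingMulticategory P κ' :=
  NatIso.ofComponents (fun c => underlyingIso (κ c) (κ' c)) fun {c d} f => by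
    change underlyingFunctor (P.map f) (κ c) (κ d) ≫ underlyingFunctor (𝟙 _) (κ d) (κ' d) =
      underlyingFunctor (𝟙 _) (κ c) (κ' c) ≫ underlyingFunctor (P.map f) (κ' c) (κ' d)
    rw [underlyingFunctor_comp, underlyingFunctor_comp, Category.comp_id, Category.id_comp]

end Functor

end UnderlyingMulticat

theorem corollary2p5 {T : Type*} [Category T] (P : T ⥤ SymMonCat.{v, u}) :
    -- the structural isomorphisms used throughout are canonical
    (∀ (c : T) (n : ℕ) (s t : Y n) (x : Fin n → P.obj c) (p q : Tree.Word s.1 t.1),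
      p.eval x = q.eval x) ∧
    -- an underlying multicategory functor for every choice of the sequences `κ`,
    -- and canonical isomorphisms between any two of them
    ∃ (U : (∀ c : T, Choice (P.obj c)) → T ⥤ Multicategory.{v, u})
      (can : ∀ κ κ' : (∀ c : T, Choice (P.obj c)), U κ ≅ U κ'),
      (∀ κ c, ((U κ).obj c).data = underlyingData (P.obj c) (κ c)) ∧
      (∀ κ (c d : T) (f : c ⟶ d),
        HEq ((U κ).map f).toMap (underlyingMap (P.map f) (κ c) (κ d))) ∧
      (∀ κ κ' c, HEq ((can κ κ').hom.app c).toMap (changeOfChoice (κ c) (κ' c))) ∧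
      (∀ κ, can κ κ = Iso.refl (U κ)) ∧
      (∀ κ κ' κ'', can κ κ' ≪≫ can κ' κ'' = can κ κ'') := by
  refine ⟨fun c n s t x p q => Tree.Word.eval_eq t.2.1 p q x,
    underlyingMulticategory P, underlyingMulticategoryIso P, fun _ _ => rfl, fun _ _ _ _ => HEq.rfl,
    fun κ κ' c => heq_of_eq (underlyingMap_id (κ c) (κ' c)), fun κ => ?_, fun κ κ' κ'' => ?_⟩
  · ext c
    exact underlyingFunctor_id (κ c)
  · ext c
    change underlyingFunctor (𝟙 _) (κ c) (κ' c) ≫ underlyingFunctor (𝟙 _) (κ' c) (κ'' c) =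
      underlyingFunctor (𝟙 _) (κ c) (κ'' c)
    rw [underlyingFunctor_comp, Category.comp_id]
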